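/- Let $\kappa$ be a field, $G$ a group, and $\sigma: G\times G\to\kappa$ a factor set, i.e. there are a unital $\kappa$-algebra $R$ and a map $\Gamma:G\to R$ such that for all $g,h\in G$: if $\sigma(g,h)=0$ then $\Gamma(g^{-1})\Gamma(gh)=0$ and $\Gamma(gh)\Gamma(h^{-1})=0$; if $\Gamma(g)\Gamma(h)=0$ then $\sigma(g,h)=0$; $\Gamma(1)=1_R$; $\Gamma(g^{-1})\Gamma(g)\Gamma(h)=\sigma(g,h)\Gamma(g^{-1})\Gamma(gh)$; and $\Gamma(g)\Gamma(h)\Gamma(h^{-1})=\sigma(g,h)\Gamma(gh)\Gamma(h^{-1})$. The twisted partial group algebra $\kappa_{par}^{\sigma}G$ is the universal unital $\kappa$-algebra generated by symbols $[g]$ $(g\in G)$ subject to $[1]=1$ and, for all $g,h\in G$: $[g^{-1}][gh]=[gh][h^{-1}]=0$ whenever $\sigma(g,h)=0$; $[g^{-1}][g][h]=\sigma(g,h)[g^{-1}][gh]$; $[g][h][h^{-1}]=\sigma(g,h)[gh][h^{-1}]$. For $\sigma=1$ it is denoted $\kappa_{par}G$; let $B\subseteq\kappa_{par}G$ be the (commutative)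 subalgebra generated by the idempotents $e_g=[g][g^{-1}]$. For each $\xi\subseteq G$ with $1\in\xi$ there is a unique $\kappa$-algebra homomorphism $f_\xi:B\to\kappa$ with $f_\xi(e_g)=1$ if $g\in\xi$ and $f_\xi(e_g)=0$ if $g\notin\xi$. Let $\mathcal I_\sigma$ be the ideal of $B$ generated by the elements $e_se_{sg}e_{sgh}$ with $\sigma(g,h)=0$ and the elements $e_se_{sg}e_{sgh}e_{sght}$ with $\sigma(g,h)\sigma(gh,t)\ne\sigma(g,ht)\sigma(h,t)$. Put $$\Omega_\sigma=\{\xi\subseteq G: 1\in\xi,\ \mathcal I_\sigma\subseteq\ker f_\xi\},$$ with the topology induced by the product topology of $\{0,1\}^G$. Let $\Gamma^\sigma(G)$ be the groupoid with set of objects $\Omega_\sigma$ whose arrows $A\to A'$ are the elements $r(g,A)$ with $r\in\kappa\setminus\{0\}$, $g^{-1}\in A$ and $gA=A'$, with composition $r(g,B)*l(h,A)=rl\,\sigma(g,h)(gh,A)$ for $B=hA$. Let $I$ be the set of its connected components. For $i\in I$ let $n_i$ be the number of objects of the $i$-th component, choose an arbitrary object $A_i$ of it, and let $H_i=\{g\in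 G: gA_i=A_i\}$ and $\sigma_i=\sigma|_{H_i\times H_i}$. Then $\sigma_i$ is a global $2$-cocycle of $H_i$ with values in $\kappa\setminus\{0\}$; let $\kappa^{\sigma_i}H_i$ be the twisted group algebra, i.e. the vector space with basis $H_i$ and the product determined by $g\cdot h=\sigma_i(g,h)\,gh$. **Theorem.** If $G$ is finite, then $\Omega_\sigma$ is discrete. If $\Omega_\sigma$ is discrete, then $\Omega_\sigma$ is finite (so that $I$ and all $n_i$ are finite) and, for every choice of the objects $A_i$, there is an isomorphism of $\kappa$-algebras $$\kappa_{par}^{\sigma}G\;\cong\;\bigoplus_{i\in I}M_{n_i}(\kappa^{\sigma_i}H_i).$$ -/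

import Mathlib

open CategoryTheory
open scoped Pointwise

universe u v w

/-- `Γ : G → R` is a partial projective `σ`-representation of the group `G` in the unital
`κ`-algebra `R`. -/
structure IsPartialProjectiveRep {κ : Type*} {G : Type*} {R : Type*} [Field κ] [Group G] [Ring R]
    [Algebra κ R] (σ : G → G → κ) (Γ : G → R) : Prop where
  zero_left : ∀ g h, σ g h = 0 → Γ g⁻¹ * Γ (g * h) = 0
  zero_right : ∀ g h, σ g h = 0 → Γ (g * h) * Γ h⁻¹ = 0
  eq_zero : ∀ g h, Γ g * Γ h = 0 → σ g h = 0
  map_one : Γ 1 = 1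
  left : ∀ g h, Γ g⁻¹ * Γ g * Γ h = σ g h • (Γ g⁻¹ * Γ (g * h))
  right : ∀ g h, Γ g * Γ h * Γ h⁻¹ = σ g h • (Γ (g * h) * Γ h⁻¹)

/-- `σ` is a factor set: the factor set of some partial projective representation of `G` in a
unital `κ`-algebra. -/
def IsFactorSet {κ : Type u} {G : Type v} [Field κ] [Group G] (σ : G → G → κ) : Prop :=
  ∃ (R : Type w) (_ : Ring R) (_ : Algebra κ R) (Γ : G → R), IsPartialProjectiveRep σ Γ

/-! ### The twisted partial group algebra -/

/-- The defining relations of the twisted partial group algebra, whose unit is `[1]`. -/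
inductive ParRel {κ : Type*} {G : Type*} [Field κ] [Group G] (σ : G → G → κ) :
    FreeAlgebra κ G → FreeAlgebra κ G → Prop
  | zero_left (g h : G) : σ g h = 0 →
      ParRel σ (FreeAlgebra.ι κ g⁻¹ * FreeAlgebra.ι κ (g * h)) 0
  | zero_right (g h : G) : σ g h = 0 →
      ParRel σ (FreeAlgebra.ι κ (g * h) * FreeAlgebra.ι κ h⁻¹) 0
  | left (g h : G) :
      ParRel σ (FreeAlgebra.ι κ g⁻¹ * FreeAlgebra.ι κ g * FreeAlgebra.ι κ h)
        (σ g h • (FreeAlgebra.ι κ g⁻¹ * FreeAlgebra.ι κ (g * h)))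
  | right (g h : G) :
      ParRel σ (FreeAlgebra.ι κ g * FreeAlgebra.ι κ h * FreeAlgebra.ι κ h⁻¹)
        (σ g h • (FreeAlgebra.ι κ (g * h) * FreeAlgebra.ι κ h⁻¹))
  | one : ParRel σ (FreeAlgebra.ι κ 1) 1

/-- The twisted partial group algebra `κ_par^σ G`. -/
abbrev ParAlg {κ : Type*} {G : Type*} [Field κ] [Group G] (σ : G → G → κ) : Type _ :=
  RingQuot (ParRel σ)

/-- The generator `[g]` of `κ_par^σ G`. -/
def ParAlg.gen {κ : Type*} {G : Type*} [Field κ] [Group G] (σ : G → G → κ) (g : G) : ParAlg σ :=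
  RingQuot.mkAlgHom κ (ParRel σ) (FreeAlgebra.ι κ g)

/-! ### The space `Ω_σ` -/

/-- The element `e_g = [g][g⁻¹]` of the (untwisted) partial group algebra `κ_par G`. -/
def parIdem (κ : Type*) {G : Type*} [Field κ] [Group G] (g : G) :
    ParAlg (fun _ _ : G => (1 : κ)) :=
  ParAlg.gen _ g * ParAlg.gen _ g⁻¹

/-- The subalgebra `B` of `κ_par G` generated by the `e_g`; it is commutative. -/
abbrev ParB (κ : Type*) (G : Type*) [Field κ] [Group G] :
    Subalgebra κ (ParAlg (fun _ _ : G => (1 : κ))) :=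
  Algebra.adjoin κ (Set.range (parIdem κ (G := G)))

/-- `e_g` as an element of `B`. -/
def ParB.e (κ : Type*) {G : Type*} [Field κ] [Group G] (g : G) : ParB κ G :=
  ⟨parIdem κ g, Algebra.subset_adjoin ⟨g, rfl⟩⟩

/-- The ideal `I_σ` of `B`. -/
def idealI {κ : Type*} {G : Type*} [Field κ] [Group G] (σ : G → G → κ) : Ideal (ParB κ G) :=
  Ideal.span
    ({x | ∃ s g h : G, σ g h = 0 ∧ x = ParB.e κ s * ParB.e κ (s * g) * ParB.e κ (s * g * h)} ∪
     {x | ∃ s g h t : G, σ g h * σ (g * h) t ≠ σ g (h * t) * σ h t ∧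
        x = ParB.e κ s * ParB.e κ (s * g) * ParB.e κ (s * g * h) * ParB.e κ (s * g * h * t)})

/-- `f : B → κ` is the character `f_ξ` attached to the subset `ξ` of `G`: it sends `e_g` to `1`
if `g ∈ ξ` and to `0` otherwise. As the `e_g` generate `B`, there is at most one such `f`. -/
def IsCharacterOf {κ : Type*} {G : Type*} [Field κ] [Group G] (ξ : Set G)
    (f : ParB κ G →ₐ[κ] κ) : Prop :=
  ∀ g : G, (g ∈ ξ → f (ParB.e κ g) = 1) ∧ (g ∉ ξ → f (ParB.e κ g) = 0)

/-- The space `Ω_σ` of all subsets `ξ` of `G` with `1 ∈ ξ` and `I_σ ⊆ ker f_ξ`. It is also the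
type of objects of the groupoid `Γ^σ(G)`. -/
@[ext]
structure OmegaSpace {κ : Type*} {G : Type*} [Field κ] [Group G] (σ : G → G → κ) where
  carrier : Set G
  one_mem : (1 : G) ∈ carrier
  le_ker : ∃ f : ParB κ G →ₐ[κ] κ, IsCharacterOf carrier f ∧ idealI σ ≤ RingHom.ker f

open Classical in
/-- The topology of `Ω_σ` as a subspace of `{0,1}^G`, with the product topology. -/
noncomputable instance {κ : Type*} {G : Type*} [Field κ] [Group G] (σ : G → G → κ) :
    TopologicalSpace (OmegaSpace σ) :=
  TopologicalSpace.induced (fun A (g : G) => decide (g ∈ A.carrier)) inferInstance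

namespace OmegaSpace

variable {κ : Type*} {G : Type*} [Field κ] [Group G] {σ : G → G → κ}

theorem sigma_ne_zero (A : OmegaSpace σ) {s g h : G} (h1 : s ∈ A.carrier)
    (h2 : s * g ∈ A.carrier) (h3 : s * g * h ∈ A.carrier) : σ g h ≠ 0 := by
  obtain ⟨f, hf, hI⟩ := A.le_ker
  intro h0
  have h4 := hI (Ideal.subset_span (Or.inl ⟨s, g, h, h0, rfl⟩))
  rw [RingHom.mem_ker] at h4
  simp [(hf _).1 h1, (hf _).1 h2, (hf _).1 h3] at h4

theorem sigma_cocycle (A : OmegaSpace σ) {s g h t : G} (h1 : s ∈ A.carrier)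
    (h2 : s * g ∈ A.carrier) (h3 : s * g * h ∈ A.carrier) (h4 : s * g * h * t ∈ A.carrier) :
    σ g h * σ (g * h) t = σ g (h * t) * σ h t := by
  obtain ⟨f, hf, hI⟩ := A.le_ker
  by_contra h0
  have h5 := hI (Ideal.subset_span (Or.inr ⟨s, g, h, t, h0, rfl⟩))
  rw [RingHom.mem_ker] at h5
  simp [(hf _).1 h1, (hf _).1 h2, (hf _).1 h3, (hf _).1 h4] at h5

end OmegaSpace

/-! ### The groupoid `Γ^σ(G)` -/

/-- The arrows `A ⟶ B` of `Γ^σ(G)`: the elements `r(g, A)` with `r ∈ κ`, `r ≠ 0`, `g⁻¹ ∈ A` and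
`gA = B`. -/
@[ext]
structure GammaHom {κ : Type*} {G : Type*} [Field κ] [Group G] {σ : G → G → κ}
    (A B : OmegaSpace σ) where
  coeff : κ
  elt : G
  coeff_ne_zero : coeff ≠ 0
  inv_mem : elt⁻¹ ∈ A.carrier
  smul_eq : elt • A.carrier = B.carrier

namespace GammaHom

variable {κ : Type*} {G : Type*} [Field κ] [Group G] {σ : G → G → κ}

theorem inv_mul_mem {A B : OmegaSpace σ} (p : GammaHom A B) {x : G} (hx : x ∈ B.carrier) :
    p.elt⁻¹ * x ∈ A.carrier := by
  rw [← p.smul_eq, Set.mem_smul_set_iff_inv_smul_mem] at hx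
  simpa using hx

theorem sigma_one_one (A : OmegaSpace σ) : σ 1 1 ≠ 0 :=
  A.sigma_ne_zero (s := 1) A.one_mem (by simpa using A.one_mem) (by simpa using A.one_mem)

theorem sigma_one_left {A B : OmegaSpace σ} (p : GammaHom A B) : σ 1 p.elt = σ 1 1 := by
  have h := A.sigma_cocycle (s := p.elt⁻¹) (g := 1) (h := 1) (t := p.elt) p.inv_mem
    (by simpa using p.inv_mem) (by simpa using p.inv_mem) (by simpa using A.one_mem)
  have h0 := A.sigma_ne_zero (s := p.elt⁻¹) (g := 1) (h := p.elt) p.inv_mem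
    (by simpa using p.inv_mem) (by simpa using A.one_mem)
  simp only [one_mul] at h
  exact (mul_right_cancel₀ h0 h).symm

theorem sigma_one_right {A B : OmegaSpace σ} (p : GammaHom A B) : σ p.elt 1 = σ 1 1 := by
  have h := A.sigma_cocycle (s := p.elt⁻¹) (g := p.elt) (h := 1) (t := 1) p.inv_mem
    (by simpa using A.one_mem) (by simpa using A.one_mem) (by simpa using A.one_mem)
  have h0 := A.sigma_ne_zero (s := p.elt⁻¹) (g := p.elt) (h := 1) p.inv_mem
    (by simpa using A.one_mem) (by simpa using A.one_mem)
  simp only [mul_one] at h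
  exact mul_left_cancel₀ h0 h

theorem sigma_inv {A B : OmegaSpace σ} (p : GammaHom A B) :
    σ p.elt p.elt⁻¹ = σ p.elt⁻¹ p.elt := by
  have h := A.sigma_cocycle (s := p.elt⁻¹) (g := p.elt) (h := p.elt⁻¹) (t := p.elt) p.inv_mem
    (by simpa using A.one_mem) (by simpa using p.inv_mem) (by simpa using A.one_mem)
  simp only [mul_inv_cancel, inv_mul_cancel, sigma_one_left, sigma_one_right] at h
  rw [mul_comm] at h
  exact mul_left_cancel₀ (sigma_one_one A) h

theorem sigma_inv_ne_zero {A B : OmegaSpace σ} (p : GammaHom A B) : σ p.elt⁻¹ p.elt ≠ 0 :=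
  A.sigma_ne_zero (s := 1) (g := p.elt⁻¹) (h := p.elt) A.one_mem
    (by simpa using p.inv_mem) (by simpa using A.one_mem)

/-- The identity `σ(1,1)⁻¹(1, A)`; one has `σ(1,1) = 1` if `σ` is a factor set and `Ω_σ` is not
empty. -/
def id (A : OmegaSpace σ) : GammaHom A A where
  coeff := (σ 1 1)⁻¹
  elt := 1
  coeff_ne_zero := inv_ne_zero (sigma_one_one A)
  inv_mem := by simpa using A.one_mem
  smul_eq := one_smul _ _

/-- The composition `r(g, B) * l(h, A) = r l σ(g,h) (gh, A)` for `B = hA`, where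
`p = l(h, A)` and `q = r(g, B)`. -/
def comp {A B C : OmegaSpace σ} (p : GammaHom A B) (q : GammaHom B C) : GammaHom A C where
  coeff := q.coeff * p.coeff * σ q.elt p.elt
  elt := q.elt * p.elt
  coeff_ne_zero := mul_ne_zero (mul_ne_zero q.coeff_ne_zero p.coeff_ne_zero)
    (A.sigma_ne_zero (s := p.elt⁻¹ * q.elt⁻¹) (p.inv_mul_mem q.inv_mem)
      (by simpa using p.inv_mem) (by simpa using A.one_mem))
  inv_mem := by rw [mul_inv_rev]; exact p.inv_mul_mem q.inv_mem
  smul_eq := by rw [mul_smul, p.smul_eq, q.smul_eq]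

/-- The inverse of `r(g, A)`. -/
def inv {A B : OmegaSpace σ} (p : GammaHom A B) : GammaHom B A where
  coeff := (p.coeff * σ p.elt⁻¹ p.elt * σ 1 1)⁻¹
  elt := p.elt⁻¹
  coeff_ne_zero := inv_ne_zero (mul_ne_zero
    (mul_ne_zero p.coeff_ne_zero p.sigma_inv_ne_zero) (sigma_one_one A))
  inv_mem := by
    rw [← p.smul_eq, Set.mem_smul_set_iff_inv_smul_mem]
    simpa using A.one_mem
  smul_eq := by rw [← p.smul_eq, inv_smul_smul]

end GammaHom

/-- The groupoid `Γ^σ(G)`, with `Ω_σ` as its set of objects. -/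
instance gammaGroupoid {κ : Type*} {G : Type*} [Field κ] [Group G] (σ : G → G → κ) :
    Groupoid (OmegaSpace σ) where
  Hom A B := GammaHom A B
  id A := GammaHom.id A
  comp p q := p.comp q
  inv p := p.inv
  id_comp {A B} p := by
    have h := GammaHom.sigma_one_one A
    apply GammaHom.ext
    · simp [GammaHom.comp, GammaHom.id, GammaHom.sigma_one_right, h]
    · simp [GammaHom.comp, GammaHom.id]
  comp_id {A B} p := by
    have h := GammaHom.sigma_one_one A
    apply GammaHom.ext
    · simp only [GammaHom.comp, GammaHom.id, GammaHom.sigma_one_left]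
      field_simp
    · simp [GammaHom.comp, GammaHom.id]
  assoc {A B C D} p q r := by
    apply GammaHom.ext
    · have h := A.sigma_cocycle (s := p.elt⁻¹ * (q.elt⁻¹ * r.elt⁻¹)) (g := r.elt) (h := q.elt)
        (t := p.elt) (p.inv_mul_mem (q.inv_mul_mem r.inv_mem))
        (by simpa [mul_assoc] using p.inv_mul_mem q.inv_mem)
        (by simpa [mul_assoc] using p.inv_mem) (by simpa [mul_assoc] using A.one_mem)
      simp only [GammaHom.comp]
      linear_combination (-(r.coeff * q.coeff * p.coeff)) * h
    · simp [GammaHom.comp, mul_assoc]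
  inv_comp {A B} p := by
    have h1 := GammaHom.sigma_one_one A
    have h2 := p.sigma_inv_ne_zero
    have h3 := p.coeff_ne_zero
    apply GammaHom.ext
    · simp only [GammaHom.comp, GammaHom.id, GammaHom.inv, p.sigma_inv]
      field_simp
    · simp [GammaHom.comp, GammaHom.id, GammaHom.inv]
  comp_inv {A B} p := by
    have h1 := GammaHom.sigma_one_one A
    have h2 := p.sigma_inv_ne_zero
    have h3 := p.coeff_ne_zero
    apply GammaHom.ext
    · simp only [GammaHom.comp, GammaHom.id, GammaHom.inv]
      field_simp
    · simp [GammaHom.comp, GammaHom.id, GammaHom.inv]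

/-! ### Global 2-cocycles and twisted group algebras -/

/-- A global 2-cocycle of `H` with values in `κ \ {0}`, for the trivial action. -/
structure GlobalCocycle (κ : Type*) (H : Type*) [Field κ] [Group H] where
  toFun : H → H → κ
  ne_zero : ∀ g h, toFun g h ≠ 0
  cocycle : ∀ g h t, toFun g h * toFun (g * h) t = toFun g (h * t) * toFun h t

/-- The twisted group algebra `κ^c H`: the vector space with basis `H` and the product determined
by `g * h = c(g,h) gh`. -/
def TwistedGroupAlgebra {κ : Type*} {H : Type*} [Field κ] [Group H] (_c : GlobalCocycle κ H) :
    Type _ :=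
  H →₀ κ

namespace TwistedGroupAlgebra

theorem lift_single {κ : Type*} {H : Type*} [Field κ] {M : Type*} [AddCommGroup M] [Module κ M]
    (F : H → M) (g : H) : Finsupp.lift M κ H F (Finsupp.single g 1) = F g := by
  simp

variable {κ : Type*} {H : Type*} [Field κ] [Group H] (c : GlobalCocycle κ H)

noncomputable instance : AddCommGroup (TwistedGroupAlgebra c) :=
  inferInstanceAs (AddCommGroup (H →₀ κ))

noncomputable instance : Module κ (TwistedGroupAlgebra c) :=
  inferInstanceAs (Module κ (H →₀ κ))

/-- The element `r g` of `κ^c H`. -/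
noncomputable def single (g : H) (r : κ) : TwistedGroupAlgebra c := Finsupp.single g r

/-- The product of `κ^c H`, as a bilinear map. -/
noncomputable def mulHom :
    TwistedGroupAlgebra c →ₗ[κ] TwistedGroupAlgebra c →ₗ[κ] TwistedGroupAlgebra c :=
  Finsupp.lift (TwistedGroupAlgebra c →ₗ[κ] TwistedGroupAlgebra c) κ H fun g =>
    Finsupp.lift (TwistedGroupAlgebra c) κ H fun h => single c (g * h) (c.toFun g h)

theorem smul_single (s : κ) (g : H) (r : κ) : s • single c g r = single c g (s * r) :=
  Finsupp.smul_single s g r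

theorem mulHom_single (g h : H) (r s : κ) :
    mulHom c (single c g r) (single c h s) = single c (g * h) (r * s * c.toFun g h) := by
  have h1 : mulHom c (single c g r) = r • mulHom c (single c g 1) := by
    rw [← map_smul, smul_single, mul_one]
  have h2 : single c h s = s • single c h 1 := by rw [smul_single, mul_one]
  have h3 : mulHom c (single c g 1) (single c h 1) = single c (g * h) (c.toFun g h) :=
    (LinearMap.congr_fun (lift_single (M := TwistedGroupAlgebra c →ₗ[κ] TwistedGroupAlgebra c) _ g)
      (single c h 1)).trans (lift_single (M := TwistedGroupAlgebra c) _ h)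
  rw [h1, h2, map_smul, LinearMap.smul_apply, h3, smul_single, smul_single]
  congr 1
  ring

theorem induction {P : TwistedGroupAlgebra c → Prop} (x : TwistedGroupAlgebra c)
    (h0 : P 0) (hadd : ∀ x y, P x → P y → P (x + y)) (hs : ∀ g r, P (single c g r)) : P x :=
  Finsupp.induction_linear (motive := P) x h0 hadd hs

theorem mulHom_assoc (x y z : TwistedGroupAlgebra c) :
    mulHom c (mulHom c x y) z = mulHom c x (mulHom c y z) := by
  induction x using induction with
  | h0 => simp
  | hadd x x' hx hx' => simp [hx, hx']
  | hs g r =>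
    induction y using induction with
    | h0 => simp
    | hadd y y' hy hy' => simp [hy, hy']
    | hs h s =>
      induction z using induction with
      | h0 => simp
      | hadd z z' hz hz' => simp [hz, hz']
      | hs t u =>
        simp only [mulHom_single, mul_assoc]
        congr 1
        linear_combination (r * s * u) * c.cocycle g h t

theorem cocycle_one_left (g : H) : c.toFun 1 g = c.toFun 1 1 := by
  have h := c.cocycle 1 1 g
  simp only [one_mul] at h
  exact (mul_right_cancel₀ (c.ne_zero 1 g) h).symm

theorem cocycle_one_right (g : H) : c.toFun g 1 = c.toFun 1 1 := by
  have h := c.cocycle g 1 1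
  simp only [mul_one] at h
  exact mul_left_cancel₀ (c.ne_zero g 1) h

noncomputable instance : Ring (TwistedGroupAlgebra c) where
  mul x y := mulHom c x y
  one := single c 1 (c.toFun 1 1)⁻¹
  zero_mul x := by change mulHom c 0 x = 0; simp
  mul_zero x := by change mulHom c x 0 = 0; simp
  left_distrib x y z := map_add (mulHom c x) y z
  right_distrib x y z := by
    change mulHom c (x + y) z = mulHom c x z + mulHom c y z
    simp
  mul_assoc := mulHom_assoc c
  one_mul x := by
    change mulHom c (single c 1 (c.toFun 1 1)⁻¹) x = x
    induction x using induction with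
    | h0 => simp
    | hadd x y hx hy => rw [map_add, hx, hy]
    | hs g r =>
      have h := c.ne_zero 1 1
      rw [mulHom_single, one_mul, cocycle_one_left c g]
      congr 1
      field_simp
  mul_one x := by
    change mulHom c x (single c 1 (c.toFun 1 1)⁻¹) = x
    induction x using induction with
    | h0 => simp
    | hadd x y hx hy => rw [map_add, LinearMap.add_apply, hx, hy]
    | hs g r =>
      have h := c.ne_zero 1 1
      rw [mulHom_single, mul_one, cocycle_one_right c g]
      congr 1
      field_simp
  neg_add_cancel := neg_add_cancel
  sub_eq_add_neg := sub_eq_add_neg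
  zsmul := fun n x => n • x
  zsmul_zero' := SubNegMonoid.zsmul_zero'
  zsmul_succ' := SubNegMonoid.zsmul_succ'
  zsmul_neg' := SubNegMonoid.zsmul_neg'

noncomputable instance : Algebra κ (TwistedGroupAlgebra c) :=
  Algebra.ofModule (fun r x y => by
      change mulHom c (r • x) y = r • mulHom c x y
      simp)
    (fun r x y => map_smul (mulHom c x) r y)

end TwistedGroupAlgebra

/-- The stabilizer `H_A = {g ∈ G : gA = A}` of `A ∈ Ω_σ`. -/
def OmegaSpace.stab {κ : Type*} {G : Type*} [Field κ] [Group G] {σ : G → G → κ}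
    (A : OmegaSpace σ) : Subgroup G :=
  MulAction.stabilizer G A.carrier

theorem OmegaSpace.mem_of_mem_stab {κ : Type*} {G : Type*} [Field κ] [Group G] {σ : G → G → κ}
    (A : OmegaSpace σ) {g : G} (hg : g ∈ A.stab) : g ∈ A.carrier := by
  have h : g • A.carrier = A.carrier := hg
  rw [← h]
  exact ⟨1, A.one_mem, by simp⟩

/-- The restriction of `σ` to `H_A × H_A`; it is a global 2-cocycle as `H_A ⊆ A`. -/
def OmegaSpace.cocycle {κ : Type*} {G : Type*} [Field κ] [Group G] {σ : G → G → κ}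
    (A : OmegaSpace σ) : GlobalCocycle κ A.stab where
  toFun g h := σ g h
  ne_zero g h := A.sigma_ne_zero (s := 1) A.one_mem
    (by simpa using A.mem_of_mem_stab g.2)
    (by simpa using A.mem_of_mem_stab (mul_mem g.2 h.2))
  cocycle g h t := by
    simpa using A.sigma_cocycle (s := 1) (g := g) (h := h) (t := t) A.one_mem
      (by simpa using A.mem_of_mem_stab g.2)
      (by simpa using A.mem_of_mem_stab (mul_mem g.2 h.2))
      (by simpa using A.mem_of_mem_stab (mul_mem (mul_mem g.2 h.2) t.2))

/-! ### The idempotents of the twisted partial group algebra -/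

namespace ParAlg

variable {κ : Type*} {G : Type*} [Field κ] [Group G] (σ : G → G → κ)

/-! In `κ_par^σ G` the elements `e_g = σ(g,g⁻¹)⁻¹[g][g⁻¹]` are commuting idempotents with `[g]e_h =
e_{gh}[g]` and `[g][h] = σ(g,h) e_g [gh]`. Consequently `e_s e_{sg} e_{sgh}` vanishes when `σ(g,h) =
0`, and `e_s e_{sg} e_{sgh} e_{sght}` vanishes when the cocycle identity fails at `(g,h,t)`. These
are exactly the generators of `I_σ`, so the `e_g` satisfy the relations that cut out `Ω_σ`. The
conditions defining `Ω_σ` each involve finitely many coordinates, so `Ω_σ` is closed in the compact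
space `{0,1}^G`; if it is discrete, it is finite. The nonzero atoms of the Boolean algebra generated
by the `e_g` then occur only at points of `Ω_σ`, which gives orthogonal idempotents `p_A`, for `A ∈
Ω_σ`, with sum `1` (`exists_isAtomFamily`). The elements `[g]p_A` span the algebra, and `[g]p_A = 0`
unless `g⁻¹ ∈ A`, that is, unless `1(g,A)` is an arrow of the groupoid: `κ_par^σ G` is the twisted
algebra of a groupoid with finitely many objects. Such an algebra is the product over its components
of matrix rings over twisted group algebras of isotropy groups. Choosing arrows `γ_x : A_i ⟶ x`
turns each arrow `x ⟶ y` into a loop at `A_i`, placed in the entry `(y,x)`; this defines the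
representation `componentHom`. Injectivity of the product of these representations comes from
recovering `v p_x` from column `x` of the matrix of `v` (`sum_transport_componentHom`); surjectivity
comes from arrows mapping to matrix units times loops (`componentHom_arrowVal`). -/

theorem gen_one : gen σ 1 = 1 := by
  have := RingQuot.mkAlgHom_rel κ (ParRel.one (σ := σ))
  simpa [gen] using this

theorem gen_zero_left (g h : G) (h0 : σ g h = 0) : gen σ g⁻¹ * gen σ (g * h) = 0 := by
  have := RingQuot.mkAlgHom_rel κ (ParRel.zero_left (σ := σ) g h h0)
  simpa [gen] using this

theorem gen_zero_right (g h : G) (h0 : σ g h = 0) : gen σ (g * h) * gen σ h⁻¹ = 0 := by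
  have := RingQuot.mkAlgHom_rel κ (ParRel.zero_right (σ := σ) g h h0)
  simpa [gen] using this

theorem gen_left (g h : G) :
    gen σ g⁻¹ * gen σ g * gen σ h = σ g h • (gen σ g⁻¹ * gen σ (g * h)) := by
  have := RingQuot.mkAlgHom_rel κ (ParRel.left (σ := σ) g h)
  simpa [gen] using this

theorem gen_right (g h : G) :
    gen σ g * gen σ h * gen σ h⁻¹ = σ g h • (gen σ (g * h) * gen σ h⁻¹) := by
  have := RingQuot.mkAlgHom_rel κ (ParRel.right (σ := σ) g h)
  simpa [gen] using this

/-- The idempotent `σ(g,g⁻¹)⁻¹[g][g⁻¹]` of `κ_par^σ G`. -/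
noncomputable def idem (g : G) : ParAlg σ := (σ g g⁻¹)⁻¹ • (gen σ g * gen σ g⁻¹)

/-- The zero relation for the pair `(g, g⁻¹)` reads `[1][g] = 0`. Hence the convention `0⁻¹ = 0` in
`idem` is harmless: where the scalar vanishes, so does the generator. -/
theorem gen_eq_zero_of_right (g : G) (h0 : σ g g⁻¹ = 0) : gen σ g = 0 := by
  simpa [gen_one] using gen_zero_right σ g g⁻¹ h0

theorem gen_eq_zero_of_left (g : G) (h0 : σ g⁻¹ g = 0) : gen σ g = 0 := by
  simpa [gen_one] using gen_zero_left σ g⁻¹ g h0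

theorem idem_mul_gen (g : G) : idem σ g * gen σ g = gen σ g := by
  by_cases h0 : σ g g⁻¹ = 0
  · simp [gen_eq_zero_of_right σ g h0]
  · have h := gen_right σ g g⁻¹
    simp only [inv_inv, mul_inv_cancel, gen_one, one_mul] at h
    rw [idem, smul_mul_assoc, h, inv_smul_smul₀ h0]

theorem gen_mul_idem (g : G) : gen σ g * idem σ g⁻¹ = gen σ g := by
  by_cases h0 : σ g⁻¹ g = 0
  · simp [gen_eq_zero_of_left σ g h0]
  · have h := gen_left σ g⁻¹ g
    simp only [inv_inv, inv_mul_cancel, gen_one, mul_one] at h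
    rw [idem, inv_inv, mul_smul_comm, ← mul_assoc, h, inv_smul_smul₀ h0]

/-- Both sides are multiples of `x = [gh][h⁻¹]`, by the left and right relations. If a normalising
scalar vanishes, both sides are zero; otherwise the two multiples must be compared. -/
theorem gen_mul_idem_comm (g h : G) : gen σ g * idem σ h = idem σ (g * h) * gen σ g := by
  by_cases hh : σ h h⁻¹ = 0
  · have h1 := gen_eq_zero_of_right σ h hh
    have h2 : gen σ (g * h) * gen σ (g * h)⁻¹ * gen σ g = 0 := by
      have := gen_left σ (g * h)⁻¹ g
      rw [inv_inv] at this
      rw [this]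
      have h3 : (g * h)⁻¹ * g = h⁻¹ := by group
      have h4 : gen σ h⁻¹ = 0 := gen_eq_zero_of_left σ h⁻¹ (by simpa using hh)
      rw [h3, h4]
      simp
    rw [idem, idem, h1, smul_mul_assoc, h2]
    simp
  by_cases hg : σ (g * h) (g * h)⁻¹ = 0
  · have h1 := gen_eq_zero_of_right σ (g * h) hg
    rw [idem, idem, mul_smul_comm, ← mul_assoc, gen_right, h1]
    simp
  obtain ⟨x, hx⟩ : ∃ x, x = gen σ (g * h) * gen σ h⁻¹ := ⟨_, rfl⟩
  have e1 : gen σ g * gen σ h * gen σ h⁻¹ = σ g h • x := by rw [hx, gen_right]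
  have e2 : gen σ (g * h) * gen σ (g * h)⁻¹ * gen σ g = σ (g * h)⁻¹ g • x := by
    have := gen_left σ (g * h)⁻¹ g
    rw [inv_inv] at this
    rw [this, hx]
    congr 3
    group
  have e3 : gen σ (g * h) * gen σ (g * h)⁻¹ * x = σ (g * h) (g * h)⁻¹ • x := by
    have := gen_right σ (g * h) (g * h)⁻¹
    simp only [inv_inv, mul_inv_cancel, gen_one, one_mul] at this
    rw [hx, ← mul_assoc, this, smul_mul_assoc]
  have e4 : x * (gen σ h * gen σ h⁻¹) = σ h h⁻¹ • x := by
    have := gen_left σ h h⁻¹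
    simp only [mul_inv_cancel, gen_one, mul_one] at this
    rw [hx, mul_assoc, ← mul_assoc _ (gen σ h), this, mul_smul_comm]
  -- Both sides evaluate `[gh][(gh)⁻¹][g][h][h⁻¹]`, bracketed in two ways. If `x ≠ 0`, this gives
  -- the identity between values of `σ` that makes the coefficients agree.
  have e5 : (σ g h * σ (g * h) (g * h)⁻¹) • x = (σ (g * h)⁻¹ g * σ h h⁻¹) • x := by
    rw [mul_smul, mul_smul, ← e3, ← mul_smul_comm, ← e1, ← e4, ← smul_mul_assoc, ← e2]
    simp only [mul_assoc]
  rw [idem, idem, mul_smul_comm, ← mul_assoc, e1, smul_mul_assoc, e2]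
  by_cases hx0 : x = 0
  · simp [hx0]
  have h6 := smul_left_injective κ hx0 e5
  rw [smul_smul, smul_smul]
  congr 1
  field_simp
  linear_combination h6

theorem idem_one : idem σ 1 = 1 := by
  simpa [gen_one] using idem_mul_gen σ 1

theorem idem_mul_self (g : G) : idem σ g * idem σ g = idem σ g := by
  conv_lhs => enter [2]; rw [idem]
  rw [mul_smul_comm, ← mul_assoc, idem_mul_gen, idem]

theorem idem_mul_comm (g h : G) : idem σ g * idem σ h = idem σ h * idem σ g := by
  have h1 : g * (g⁻¹ * h) = h := by group
  have h2 : idem σ g * idem σ h = (σ g g⁻¹)⁻¹ • (gen σ g * gen σ g⁻¹) * idem σ h := by rw [← idem]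
  rw [h2, smul_mul_assoc, mul_assoc, gen_mul_idem_comm, ← mul_assoc, gen_mul_idem_comm, h1,
    mul_assoc, ← mul_smul_comm, ← idem]

/-- Since `[h] = [h]e_{h⁻¹}`, the factor `[h][h⁻¹]` needed for the right relation is already
present; `e_{h⁻¹}` then moves to the left of `[gh]` and becomes `e_g`. -/
theorem gen_mul_gen (g h : G) : gen σ g * gen σ h = σ g h • (idem σ g * gen σ (g * h)) := by
  have h1 : gen σ g * gen σ h = gen σ g * gen σ h * idem σ h⁻¹ := by
    rw [mul_assoc, gen_mul_idem]
  have h2 : idem σ g * gen σ (g * h) = gen σ (g * h) * idem σ h⁻¹ := by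
    rw [gen_mul_idem_comm]
    congr 2
    group
  rw [h1, h2, idem, inv_inv, mul_smul_comm, ← mul_assoc, gen_right,
    smul_mul_assoc, mul_smul_comm, smul_comm, mul_assoc]

theorem gen_mul_gen_mul_idem (g h : G) :
    gen σ g * (gen σ h * idem σ h⁻¹) = σ g h • (gen σ (g * h) * idem σ h⁻¹) := by
  have h2 : g * h * h⁻¹ = g := by group
  rw [gen_mul_idem, gen_mul_gen, gen_mul_idem_comm, h2]

/-- The conjugation rule pulls everything inside `[s] ⋯ [s⁻¹]`, which reduces to `s = 1`. There
`e_{gh}e_g` contains the factor `[gh][h⁻¹]`, which is zero. -/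
theorem idem_triple_eq_zero (s g h : G) (h0 : σ g h = 0) :
    idem σ s * idem σ (s * g) * idem σ (s * g * h) = 0 := by
  have h1 : idem σ g * idem σ (g * h) = 0 := by
    rw [idem_mul_comm, idem, smul_mul_assoc, mul_assoc, gen_mul_idem_comm, idem]
    have h2 : (g * h)⁻¹ * g = h⁻¹ := by group
    have h3 := gen_zero_right σ g h h0
    rw [h2, inv_inv, smul_mul_assoc, mul_smul_comm, mul_assoc, ← mul_assoc (gen σ (g * h)), h3]
    simp
  have h2 : idem σ s = (σ s s⁻¹)⁻¹ • (gen σ s * gen σ s⁻¹) := rfl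
  have h3 : s⁻¹ * (s * g) = g := by group
  have h4 : s⁻¹ * (s * g * h) = g * h := by group
  rw [h2, mul_assoc, smul_mul_assoc, mul_assoc, ← mul_assoc (gen σ s⁻¹), gen_mul_idem_comm,
    mul_assoc, gen_mul_idem_comm, h3, h4, ← mul_assoc (idem σ g), h1]
  simp

/-- The two bracketings of `[g][h][t]` are the two sides of the cocycle identity times the same
element `e_g e_{gh} [ght]`. If the scalars differ, that element is zero; the factor `s` is removed
by conjugation. -/
theorem idem_quadruple_eq_zero (s g h t : G)
    (h0 : σ g h * σ (g * h) t ≠ σ g (h * t) * σ h t) :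
    idem σ s * idem σ (s * g) * idem σ (s * g * h) * idem σ (s * g * h * t) = 0 := by
  have e : (σ g h * σ (g * h) t) • (idem σ g * idem σ (g * h) * gen σ (g * h * t)) =
      (σ g (h * t) * σ h t) • (idem σ g * idem σ (g * h) * gen σ (g * h * t)) := by
    have e1 : gen σ g * gen σ h * gen σ t =
        (σ g h * σ (g * h) t) • (idem σ g * idem σ (g * h) * gen σ (g * h * t)) := by
      rw [gen_mul_gen, smul_mul_assoc, mul_assoc, gen_mul_gen, mul_smul_comm, smul_smul,
        ← mul_assoc (idem σ g)]
    have e2 : gen σ g * (gen σ h * gen σ t) =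
        (σ g (h * t) * σ h t) • (idem σ g * idem σ (g * h) * gen σ (g * h * t)) := by
      rw [gen_mul_gen σ h, mul_smul_comm, ← mul_assoc, gen_mul_idem_comm, mul_assoc, gen_mul_gen,
        mul_smul_comm, smul_smul, ← mul_assoc, idem_mul_comm σ (g * h), mul_comm (σ h t),
        ← mul_assoc g]
    rw [← e1, ← e2, mul_assoc]
  have h1 : idem σ g * idem σ (g * h) * idem σ (g * h * t) = 0 := by
    have h2 : idem σ g * idem σ (g * h) * gen σ (g * h * t) = 0 := by
      by_contra hne
      exact h0 (smul_left_injective κ hne e)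
    have h3 : idem σ (g * h * t) =
      (σ (g * h * t) (g * h * t)⁻¹)⁻¹ • (gen σ (g * h * t) * gen σ (g * h * t)⁻¹) := rfl
    rw [h3, mul_smul_comm, ← mul_assoc, h2]
    simp
  have h2 : idem σ s = (σ s s⁻¹)⁻¹ • (gen σ s * gen σ s⁻¹) := rfl
  have h3 : s⁻¹ * (s * g) = g := by group
  have h4 : s⁻¹ * (s * g * h) = g * h := by group
  have h5 : s⁻¹ * (s * g * h * t) = g * h * t := by group
  rw [h2, smul_mul_assoc, smul_mul_assoc, smul_mul_assoc, mul_assoc (gen σ s), gen_mul_idem_comm,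
    mul_assoc (gen σ s), mul_assoc (idem σ _), gen_mul_idem_comm, mul_assoc (gen σ s),
    mul_assoc (idem σ _), mul_assoc (idem σ _), gen_mul_idem_comm, h3, h4, h5,
    ← mul_assoc (idem σ (g * h)), ← mul_assoc (idem σ g), ← mul_assoc (idem σ g), h1]
  simp

end ParAlg

/-! ### Characters and the topology of `Ω_σ` -/

section Characters

variable {κ : Type*} {G : Type*} [Field κ] [Group G]

open Classical in
/-- The partial shift by `g` on the functions on `{x | x⁻¹ ∈ ξ}`. -/
noncomputable def partialShift (κ : Type*) [Field κ] (ξ : Set G) (g : G) :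
    Module.End κ ({x : G // x⁻¹ ∈ ξ} → κ) where
  toFun v x := if h : x.1⁻¹ * g ∈ ξ then v ⟨g⁻¹ * x.1, by simpa using h⟩ else 0
  map_add' v w := by ext x; dsimp; split_ifs <;> simp
  map_smul' r v := by ext x; dsimp; split_ifs <;> simp

open Classical in
theorem partialShift_apply (ξ : Set G) (g : G) (v : {x : G // x⁻¹ ∈ ξ} → κ)
    (x : {x : G // x⁻¹ ∈ ξ}) : partialShift κ ξ g v x =
      if h : x.1⁻¹ * g ∈ ξ then v ⟨g⁻¹ * x.1, by simpa using h⟩ else 0 := rfl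

/-- The representation of `κ_par G` by partial shifts. -/
noncomputable def partialShiftRep (κ : Type*) [Field κ] (ξ : Set G) :
    ParAlg (fun _ _ : G => (1 : κ)) →ₐ[κ] Module.End κ ({x : G // x⁻¹ ∈ ξ} → κ) :=
  RingQuot.liftAlgHom κ ⟨FreeAlgebra.lift κ (partialShift κ ξ), by
    intro a b hab
    induction hab with
    | zero_left g h h0 => exact absurd h0 one_ne_zero
    | zero_right g h h0 => exact absurd h0 one_ne_zero
    | left g h =>
      ext v x
      have hx := x.2
      by_cases h1 : x.1⁻¹ * g⁻¹ ∈ ξ <;> by_cases h2 : x.1⁻¹ * h ∈ ξ <;>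
        simp [partialShift_apply, mul_assoc, h1, h2, hx]
    | right g h =>
      ext v x
      by_cases h1 : x.1⁻¹ * g ∈ ξ <;> by_cases h2 : x.1⁻¹ * (g * h) ∈ ξ <;>
        simp [partialShift_apply, mul_assoc, h1, h2]
    | one =>
      ext v x
      have hx := x.2
      simp [partialShift_apply, hx]⟩

theorem partialShiftRep_gen (ξ : Set G) (g : G) :
    partialShiftRep κ ξ (ParAlg.gen _ g) = partialShift κ ξ g := by
  rw [partialShiftRep, ParAlg.gen, RingQuot.liftAlgHom_mkAlgHom_apply, FreeAlgebra.lift_ι_apply]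

open Classical in
theorem partialShiftRep_parIdem (ξ : Set G) (h1 : (1 : G)⁻¹ ∈ ξ) (g : G)
    (v : {x : G // x⁻¹ ∈ ξ} → κ) :
    partialShiftRep κ ξ (parIdem κ g) v ⟨1, h1⟩ = (if g ∈ ξ then 1 else 0) * v ⟨1, h1⟩ := by
  have h1' : (1 : G) ∈ ξ := by simpa using h1
  rw [parIdem, map_mul, partialShiftRep_gen, partialShiftRep_gen]
  simp only [Module.End.mul_apply, partialShift_apply]
  by_cases hg : g ∈ ξ <;> simp [hg, h1']

/-- Each `e_g` acts on the coordinate at `1` by a scalar, a property that passes to sums and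
products, hence to all of `B`. -/
theorem partialShiftRep_diagonal (ξ : Set G) (h1 : (1 : G)⁻¹ ∈ ξ)
    {b : ParAlg (fun _ _ : G => (1 : κ))} (hb : b ∈ ParB κ G) :
    ∃ c : κ, ∀ v, partialShiftRep κ ξ b v ⟨1, h1⟩ = c * v ⟨1, h1⟩ := by
  induction hb using Algebra.adjoin_induction with
  | mem x hx =>
    obtain ⟨g, rfl⟩ := hx
    exact ⟨_, partialShiftRep_parIdem ξ h1 g⟩
  | algebraMap r => exact ⟨r, fun v => by simp [Module.algebraMap_end_apply]⟩
  | add x y _ _ hx hy =>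
    obtain ⟨c, hc⟩ := hx
    obtain ⟨d, hd⟩ := hy
    exact ⟨c + d, fun v => by simp [hc, hd, add_mul]⟩
  | mul x y _ _ hx hy =>
    obtain ⟨c, hc⟩ := hx
    obtain ⟨d, hd⟩ := hy
    exact ⟨c * d, fun v => by simp [hc, hd, mul_assoc]⟩

/-- The character reads off the scalar by which `B` acts at the coordinate `1` of the partial shift
representation; scalars multiply, so it is an algebra map. -/
theorem exists_isCharacterOf (ξ : Set G) (h1 : (1 : G) ∈ ξ) :
    ∃ f : ParB κ G →ₐ[κ] κ, IsCharacterOf ξ f := by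
  have h1' : (1 : G)⁻¹ ∈ ξ := by simpa using h1
  let f : ParB κ G →ₐ[κ] κ := AlgHom.ofLinearMap
    { toFun := fun b => partialShiftRep κ ξ b.1 1 ⟨1, h1'⟩
      map_add' := fun a b => by simp
      map_smul' := fun r a => by simp }
    (by simp)
    (fun a b => by
      obtain ⟨c, hc⟩ := partialShiftRep_diagonal ξ h1' a.2
      have h2 := hc 1
      have h3 := hc (partialShiftRep κ ξ b.1 1)
      simp only [Pi.one_apply, mul_one] at h2
      simp [h3, h2])
  refine ⟨f, fun g => ?_⟩
  have h2 : f (ParB.e κ g) = partialShiftRep κ ξ (parIdem κ g) 1 ⟨1, h1'⟩ := rfl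
  rw [h2, partialShiftRep_parIdem]
  constructor <;> intro hg <;> simp [hg]

end Characters

/-! ### Admissible sets and compactness of `Ω_σ` -/

namespace OmegaSpace

variable {κ : Type*} {G : Type*} [Field κ] [Group G] {σ : G → G → κ}

/-- The conditions that `σ` imposes on the subsets of `G` belonging to `Ω_σ`. -/
structure Admissible (σ : G → G → κ) (ξ : Set G) : Prop where
  one_mem : (1 : G) ∈ ξ
  ne_zero : ∀ s g h, s ∈ ξ → s * g ∈ ξ → s * g * h ∈ ξ → σ g h ≠ 0
  cocycle : ∀ s g h t, s ∈ ξ → s * g ∈ ξ → s * g * h ∈ ξ → s * g * h * t ∈ ξ →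
    σ g h * σ (g * h) t = σ g (h * t) * σ h t

theorem admissible (A : OmegaSpace σ) : Admissible σ A.carrier where
  one_mem := A.one_mem
  ne_zero _ _ _ h1 h2 h3 := A.sigma_ne_zero h1 h2 h3
  cocycle _ _ _ _ h1 h2 h3 h4 := A.sigma_cocycle h1 h2 h3 h4

/-- The point of `Ω_σ` given by an admissible subset of `G`. -/
def ofAdmissible {ξ : Set G} (h : Admissible σ ξ) : OmegaSpace σ where
  carrier := ξ
  one_mem := h.one_mem
  le_ker := by
    classical
    obtain ⟨f, hf⟩ := exists_isCharacterOf (κ := κ) ξ h.one_mem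
    have hf' : ∀ g, f (ParB.e κ g) = if g ∈ ξ then 1 else 0 := fun g => by
      split_ifs with hg
      exacts [(hf g).1 hg, (hf g).2 hg]
    refine ⟨f, hf, Ideal.span_le.2 ?_⟩
    rintro x (⟨s, g, k, h0, rfl⟩ | ⟨s, g, k, t, h0, rfl⟩)
    · have := h.ne_zero s g k
      simp only [SetLike.mem_coe, RingHom.mem_ker, map_mul, hf']
      split_ifs <;> simp_all
    · have := h.cocycle s g k t
      simp only [SetLike.mem_coe, RingHom.mem_ker, map_mul, hf']
      split_ifs <;> simp_all

theorem Admissible.mono {ξ η : Set G} (h : Admissible σ ξ) (h1 : (1 : G) ∈ η) (hη : η ⊆ ξ) :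
    Admissible σ η where
  one_mem := h1
  ne_zero s g k a b c := h.ne_zero s g k (hη a) (hη b) (hη c)
  cocycle s g k t a b c d := h.cocycle s g k t (hη a) (hη b) (hη c) (hη d)

theorem Admissible.smul {ξ : Set G} (h : Admissible σ ξ) {g : G} (hg : g⁻¹ ∈ ξ) :
    Admissible σ (g • ξ) where
  one_mem := by simpa [Set.mem_smul_set_iff_inv_smul_mem] using hg
  ne_zero s k l := by
    simp only [Set.mem_smul_set_iff_inv_smul_mem, smul_eq_mul, ← mul_assoc]
    exact h.ne_zero _ k l
  cocycle s k l t := by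
    simp only [Set.mem_smul_set_iff_inv_smul_mem, smul_eq_mul, ← mul_assoc]
    exact h.cocycle _ k l t

open Classical in
/-- The indicator function of a point of `Ω_σ`. -/
noncomputable def indicator (A : OmegaSpace σ) (g : G) : Bool := decide (g ∈ A.carrier)

theorem indicator_injective : Function.Injective (indicator (σ := σ)) := by
  classical
  intro A B h
  ext g
  have := congrFun h g
  simpa [indicator] using this

theorem isEmbedding_indicator : Topology.IsEmbedding (indicator (σ := σ)) :=
  ⟨⟨rfl⟩, indicator_injective⟩

/-- Every admissibility condition constrains at most four coordinates, so each defines a clopen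
subset of `{0,1}^G`. -/
theorem isClosed_range_indicator : IsClosed (Set.range (indicator (σ := σ))) := by
  classical
  have h : Set.range (indicator (σ := σ)) = {b : G → Bool | Admissible σ {g | b g = true}} := by
    ext b
    constructor
    · rintro ⟨A, rfl⟩
      have h2 : {g | A.indicator g = true} = A.carrier := by ext g; simp [indicator]
      change Admissible σ {g | A.indicator g = true}
      rw [h2]
      exact A.admissible
    · intro hb
      refine ⟨ofAdmissible hb, ?_⟩
      funext g
      cases hg : b g <;> simp [indicator, ofAdmissible, hg]
  have h2 : {b : G → Bool | Admissible σ {g | b g = true}} =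
      {b | b 1 = true} ∩
      (⋂ (s : G) (g : G) (h : G),
        {b | (b s = true ∧ b (s * g) = true ∧ b (s * g * h) = true) → σ g h ≠ 0}) ∩
      (⋂ (s : G) (g : G) (h : G) (t : G),
        {b | (b s = true ∧ b (s * g) = true ∧ b (s * g * h) = true ∧ b (s * g * h * t) = true) →
          σ g h * σ (g * h) t = σ g (h * t) * σ h t}) := by
    ext b
    simp only [Set.mem_inter_iff, Set.mem_iInter, Set.mem_ofPred_eq]
    constructor
    · rintro ⟨a, b, c⟩
      exact ⟨⟨a, fun s g h x => b s g h x.1 x.2.1 x.2.2⟩,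
        fun s g h t x => c s g h t x.1 x.2.1 x.2.2.1 x.2.2.2⟩
    · rintro ⟨⟨a, b⟩, c⟩
      exact ⟨a, fun s g h x y z => b s g h ⟨x, y, z⟩, fun s g h t x y z w => c s g h t ⟨x, y, z, w⟩⟩
  have ho (g : G) : IsOpen {b : G → Bool | b g = true} :=
    by
    have := (isOpen_discrete ({true} : Set Bool)).preimage
      (continuous_apply (A := fun _ : G => Bool) g)
    exact this
  have hc (g : G) : IsClosed {b : G → Bool | b g = true} :=
    by
    have := (isClosed_discrete ({true} : Set Bool)).preimage
      (continuous_apply (A := fun _ : G => Bool) g)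
    exact this
  rw [h, h2]
  refine ((hc 1).inter ?_).inter ?_
  · exact isClosed_iInter fun s => isClosed_iInter fun g => isClosed_iInter fun k =>
      isClosed_imp ((ho _).inter ((ho _).inter (ho _))) isClosed_const
  · exact isClosed_iInter fun s => isClosed_iInter fun g => isClosed_iInter fun k =>
      isClosed_iInter fun t =>
      isClosed_imp ((ho _).inter ((ho _).inter ((ho _).inter (ho _)))) isClosed_const

instance : CompactSpace (OmegaSpace σ) :=
  (Topology.IsClosedEmbedding.mk isEmbedding_indicator isClosed_range_indicator).compactSpace

instance : T2Space (OmegaSpace σ) := isEmbedding_indicator.t2Space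

instance [Finite G] : Finite (OmegaSpace σ) :=
  Finite.of_injective (fun A : OmegaSpace σ => A.carrier) fun _ _ h => OmegaSpace.ext h

/-- Admissibility passes to subsets containing `1`. So every `x` in some point of `Ω_σ` yields the
point `{1, x}`, and different `x` yield different points. -/
theorem finite_iUnion_carrier [Finite (OmegaSpace σ)] :
    (⋃ A : OmegaSpace σ, A.carrier).Finite := by
  have h (x : ↥(⋃ A : OmegaSpace σ, A.carrier)) : Admissible σ {1, x.1} := by
    obtain ⟨A, hA⟩ := Set.mem_iUnion.1 x.2
    exact A.admissible.mono (by simp) (by rintro y (rfl | rfl); exacts [A.one_mem, hA])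
  refine @Set.toFinite _ _ (Finite.of_injective (fun x => ofAdmissible (h x)) fun x y hxy => ?_)
  have h2 : ({1, x.1} : Set G) = {1, y.1} := congrArg OmegaSpace.carrier hxy
  have h3 : x.1 ∈ ({1, y.1} : Set G) := h2 ▸ (by simp)
  have h4 : y.1 ∈ ({1, x.1} : Set G) := h2 ▸ (by simp)
  apply Subtype.ext
  rcases h3 with h3 | h3
  · rcases h4 with h4 | h4
    · rw [h3, h4]
    · exact h4.symm
  · exact h3

end OmegaSpace

/-! ### Matrix representations attached to the components of `Γ^σ(G)` -/

namespace GammaHom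

variable {κ : Type*} {G : Type*} [Field κ] [Group G] {σ : G → G → κ}

/-- The arrow `1(g, A)` of `Γ^σ(G)`. -/
def ofElt {A B : OmegaSpace σ} (g : G) (h1 : g⁻¹ ∈ A.carrier) (h2 : g • A.carrier = B.carrier) :
    A ⟶ B :=
  (⟨1, g, one_ne_zero, h1, h2⟩ : GammaHom A B)

/-- The arrow `sr(g, A)` for the arrow `r(g, A)` and the scalar `s`. -/
def scale {A B : OmegaSpace σ} (s : κ) (hs : s ≠ 0) (p : A ⟶ B) : A ⟶ B :=
  (⟨s * GammaHom.coeff p, GammaHom.elt p, mul_ne_zero hs (GammaHom.coeff_ne_zero p),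
    GammaHom.inv_mem p, GammaHom.smul_eq p⟩ : GammaHom A B)

theorem hom_ext {A B : OmegaSpace σ} {p q : A ⟶ B} (h1 : GammaHom.coeff p = GammaHom.coeff q)
    (h2 : GammaHom.elt p = GammaHom.elt q) : p = q :=
  GammaHom.ext h1 h2

theorem coeff_comp {A B C : OmegaSpace σ} (p : A ⟶ B) (q : B ⟶ C) :
    GammaHom.coeff (p ≫ q) =
      GammaHom.coeff q * GammaHom.coeff p * σ (GammaHom.elt q) (GammaHom.elt p) := rfl

theorem scale_comp {A B C : OmegaSpace σ} (s : κ) (hs : s ≠ 0) (p : A ⟶ B) (q : B ⟶ C) :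
    scale s hs p ≫ q = scale s hs (p ≫ q) := by
  apply hom_ext
  · simp only [scale, coeff_comp]
    ring
  · rfl

theorem comp_scale {A B C : OmegaSpace σ} (s : κ) (hs : s ≠ 0) (p : A ⟶ B) (q : B ⟶ C) :
    p ≫ scale s hs q = scale s hs (p ≫ q) := by
  apply hom_ext
  · simp only [scale, coeff_comp]
    ring
  · rfl

theorem eq_scale_ofElt {A B : OmegaSpace σ} (p : A ⟶ B) :
    p = scale (GammaHom.coeff p) (GammaHom.coeff_ne_zero p)
      (ofElt (GammaHom.elt p) (GammaHom.inv_mem p) (GammaHom.smul_eq p)) :=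
  hom_ext (mul_one _).symm rfl

/-- The element of the twisted group algebra given by an arrow from `A` to `A`. -/
noncomputable def loopVal {A : OmegaSpace σ} (p : A ⟶ A) : TwistedGroupAlgebra A.cocycle :=
  TwistedGroupAlgebra.single A.cocycle ⟨GammaHom.elt p, GammaHom.smul_eq p⟩ (GammaHom.coeff p)

theorem loopVal_scale {A : OmegaSpace σ} (s : κ) (hs : s ≠ 0) (p : A ⟶ A) :
    loopVal (scale s hs p) = s • loopVal p :=
  (TwistedGroupAlgebra.smul_single _ _ _ _).symm

theorem loopVal_comp {A : OmegaSpace σ} (p q : A ⟶ A) :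
    loopVal (p ≫ q) = loopVal q * loopVal p :=
  (TwistedGroupAlgebra.mulHom_single A.cocycle ⟨GammaHom.elt q, GammaHom.smul_eq q⟩
    ⟨GammaHom.elt p, GammaHom.smul_eq p⟩ (GammaHom.coeff q) (GammaHom.coeff p)).symm

theorem loopVal_id (A : OmegaSpace σ) : loopVal (𝟙 A) = 1 := rfl

theorem ofElt_comp {A B C : OmegaSpace σ} (g h : G) (h1 : h⁻¹ ∈ A.carrier)
    (h2 : h • A.carrier = B.carrier) (h3 : g⁻¹ ∈ B.carrier) (h4 : g • B.carrier = C.carrier)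
    (h0 : σ g h ≠ 0) (h5 : (g * h)⁻¹ ∈ A.carrier) (h6 : (g * h) • A.carrier = C.carrier) :
    ofElt h h1 h2 ≫ ofElt g h3 h4 = scale (σ g h) h0 (ofElt (g * h) h5 h6) := by
  apply hom_ext
  · simp [coeff_comp, scale, ofElt]
  · rfl

end GammaHom

section ComponentRep

variable {κ : Type*} {G : Type*} [Field κ] [Group G] {σ : G → G → κ} {A₀ : OmegaSpace σ}
  {X : Type*} (obj : X → OmegaSpace σ) (γ : ∀ x, A₀ ⟶ obj x)

open Classical in
/-- The matrix of the arrows `1(g, A)`, identified with loops at `A₀` by means of `γ`. -/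
noncomputable def componentRep (g : G) : Matrix X X (TwistedGroupAlgebra A₀.cocycle) :=
  fun y x => if h : g⁻¹ ∈ (obj x).carrier ∧ g • (obj x).carrier = (obj y).carrier then
    GammaHom.loopVal (γ x ≫ GammaHom.ofElt g h.1 h.2 ≫ inv (γ y)) else 0

theorem componentRep_of_mem {g : G} {y x : X} (h1 : g⁻¹ ∈ (obj x).carrier)
    (h2 : g • (obj x).carrier = (obj y).carrier) :
    componentRep obj γ g y x = GammaHom.loopVal (γ x ≫ GammaHom.ofElt g h1 h2 ≫ inv (γ y)) := by
  rw [componentRep, dif_pos ⟨h1, h2⟩]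

theorem componentRep_of_notMem {g : G} {y x : X}
    (h : ¬ (g⁻¹ ∈ (obj x).carrier ∧ g • (obj x).carrier = (obj y).carrier)) :
    componentRep obj γ g y x = 0 := by
  rw [componentRep, dif_neg h]

open Classical in
/-- The diagonal matrix of the indicator function of `{A | k ∈ A}`. -/
noncomputable def memDiagonal (A₀ : OmegaSpace σ) (k : G) :
    Matrix X X (TwistedGroupAlgebra A₀.cocycle) :=
  Matrix.diagonal fun x => if k ∈ (obj x).carrier then 1 else 0

variable [Fintype X]

open Classical in
theorem mul_memDiagonal_apply (M : Matrix X X (TwistedGroupAlgebra A₀.cocycle)) (k : G)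
    (y x : X) : (M * memDiagonal obj A₀ k) y x = if k ∈ (obj x).carrier then M y x else 0 := by
  rw [memDiagonal, Matrix.mul_diagonal]
  split_ifs <;> simp

open Classical in
theorem memDiagonal_mul_apply (M : Matrix X X (TwistedGroupAlgebra A₀.cocycle)) (k : G)
    (y x : X) : (memDiagonal obj A₀ k * M) y x = if k ∈ (obj y).carrier then M y x else 0 := by
  rw [memDiagonal, Matrix.diagonal_mul]
  split_ifs <;> simp

variable (hinj : Function.Injective obj)
  (hcl : ∀ x (B : OmegaSpace σ), (obj x ⟶ B) → ∃ y, obj y = B)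

omit [Fintype X] in
include hcl in
theorem exists_obj_smul {g : G} {x : X} (h1 : g⁻¹ ∈ (obj x).carrier) :
    ∃ y, g • (obj x).carrier = (obj y).carrier := by
  have h := (obj x).admissible.smul h1
  obtain ⟨y, hy⟩ := hcl x (OmegaSpace.ofAdmissible h) (GammaHom.ofElt g h1 rfl)
  exact ⟨y, by rw [hy]; rfl⟩

include hinj hcl in
-- In column `x` the matrix of `h` has at most one nonzero entry, in the row of the object `hx`, and
-- none if `h⁻¹ ∉ x`. The matrix product thus reduces to one composition of arrows, in which the
-- inner `γ_y` cancels.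
theorem componentRep_mul (g h : G) :
    componentRep obj γ g * componentRep obj γ h =
      σ g h • (componentRep obj γ (g * h) * memDiagonal obj A₀ h⁻¹) := by
  ext1 z x
  rw [Matrix.smul_apply, mul_memDiagonal_apply, Matrix.mul_apply]
  by_cases h1 : h⁻¹ ∈ (obj x).carrier
  · obtain ⟨y, hy⟩ := exists_obj_smul obj hcl h1
    rw [if_pos h1, Finset.sum_eq_single y]
    · have e1 : g⁻¹ ∈ (obj y).carrier ↔ (g * h)⁻¹ ∈ (obj x).carrier := by
        rw [← hy, Set.mem_smul_set_iff_inv_smul_mem, mul_inv_rev, smul_eq_mul]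
      have e2 : g • (obj y).carrier = (obj z).carrier ↔
          (g * h) • (obj x).carrier = (obj z).carrier := by
        rw [← hy, mul_smul]
      by_cases h2 : g⁻¹ ∈ (obj y).carrier ∧ g • (obj y).carrier = (obj z).carrier
      · have h3 := e1.1 h2.1
        have h0 : σ g h ≠ 0 := (obj x).sigma_ne_zero (s := (g * h)⁻¹) h3 (by simpa using h1)
          (by simpa using (obj x).one_mem)
        rw [componentRep_of_mem obj γ h1 hy, componentRep_of_mem obj γ h2.1 h2.2,
          componentRep_of_mem obj γ h3 (e2.1 h2.2), ← GammaHom.loopVal_comp,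
          ← GammaHom.loopVal_scale _ h0, ← GammaHom.comp_scale, ← GammaHom.scale_comp,
          ← GammaHom.ofElt_comp g h h1 hy h2.1 h2.2]
        simp
      · have h2' := h2
        rw [e1, e2] at h2'
        rw [componentRep_of_notMem obj γ h2, componentRep_of_notMem obj γ h2', zero_mul, smul_zero]
    · intro y' _ hne
      rw [componentRep_of_notMem obj γ (g := h), mul_zero]
      rintro ⟨-, h3⟩
      exact hne (hinj (OmegaSpace.ext (h3.symm.trans hy)))
    · simp
  · rw [if_neg h1, smul_zero]
    refine Finset.sum_eq_zero fun y _ => ?_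
    rw [componentRep_of_notMem obj γ (g := h) (fun h2 => h1 h2.1), mul_zero]

theorem componentRep_mul_memDiagonal (g : G) :
    componentRep obj γ g * memDiagonal obj A₀ g⁻¹ = componentRep obj γ g := by
  classical
  ext1 y x
  rw [mul_memDiagonal_apply, ite_eq_left_iff]
  intro h
  rw [componentRep_of_notMem obj γ fun h2 => h h2.1]

theorem memDiagonal_mul_componentRep (g : G) :
    memDiagonal obj A₀ g * componentRep obj γ g = componentRep obj γ g := by
  classical
  ext1 y x
  rw [memDiagonal_mul_apply, ite_eq_left_iff]
  intro h
  rw [componentRep_of_notMem]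
  rintro ⟨-, h2⟩
  apply h
  rw [← h2, Set.mem_smul_set_iff_inv_smul_mem]
  simpa using (obj x).one_mem

theorem memDiagonal_mul_comm (g h : G) :
    memDiagonal obj A₀ g * memDiagonal obj A₀ h = memDiagonal obj A₀ h * memDiagonal obj A₀ g := by
  ext1 y x
  rw [memDiagonal_mul_apply, mul_memDiagonal_apply]
  by_cases hyx : y = x
  · rw [hyx]
  · simp [memDiagonal, hyx]

open Classical in
omit [Fintype X] in
include hinj in
theorem componentRep_one (h11 : σ 1 1 = 1) : componentRep obj γ 1 = 1 := by
  ext1 y x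
  by_cases hyx : y = x
  · subst hyx
    have h1 : (1 : G)⁻¹ ∈ (obj y).carrier := by simpa using (obj y).one_mem
    have h2 : GammaHom.ofElt 1 h1 (one_smul G _) = 𝟙 (obj y) :=
      GammaHom.hom_ext (by change 1 = (σ 1 1)⁻¹; simp [h11]) rfl
    rw [Matrix.one_apply_eq, componentRep_of_mem obj γ h1 (one_smul G _), h2]
    simp [GammaHom.loopVal_id]
  · rw [Matrix.one_apply_ne hyx, componentRep_of_notMem]
    rintro ⟨-, h⟩
    exact hyx (hinj (OmegaSpace.ext (by rw [← h, one_smul])))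

include hinj hcl in
-- A nonzero column needs an object containing `(gh)⁻¹`, `h⁻¹` and `1`; such a chain forces `σ(g,h)
-- ≠ 0`.
theorem componentRep_zero_left (g h : G) (h0 : σ g h = 0) :
    componentRep obj γ g⁻¹ * componentRep obj γ (g * h) = 0 := by
  rw [componentRep_mul obj γ hinj hcl, inv_mul_cancel_left, ← componentRep_mul_memDiagonal,
    mul_assoc]
  ext1 y x
  rw [Matrix.smul_apply, ← mul_assoc, mul_memDiagonal_apply, mul_memDiagonal_apply]
  split_ifs with h1 h2
  · exact absurd h0 ((obj x).sigma_ne_zero (s := (g * h)⁻¹) h1 (by simpa using h2)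
      (by simpa using (obj x).one_mem))
  all_goals simp

include hinj hcl in
theorem componentRep_zero_right (g h : G) (h0 : σ g h = 0) :
    componentRep obj γ (g * h) * componentRep obj γ h⁻¹ = 0 := by
  rw [componentRep_mul obj γ hinj hcl, mul_inv_cancel_right, inv_inv,
    ← memDiagonal_mul_componentRep]
  ext1 y x
  rw [Matrix.smul_apply, mul_memDiagonal_apply, memDiagonal_mul_apply, Matrix.zero_apply]
  split_ifs with h1 h2
  · rw [componentRep_of_notMem, smul_zero]
    rintro ⟨h3, -⟩
    exact absurd h0 ((obj x).sigma_ne_zero (s := g⁻¹) h3 (by simpa using (obj x).one_mem)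
      (by simpa using h1))
  all_goals simp

open Classical in
/-- The representation of `κ_par^σ G` attached to a connected component of `Γ^σ(G)`. -/
noncomputable def componentHom (h11 : σ 1 1 = 1) :
    ParAlg σ →ₐ[κ] Matrix X X (TwistedGroupAlgebra A₀.cocycle) :=
  RingQuot.liftAlgHom κ ⟨FreeAlgebra.lift κ (componentRep obj γ), by
    intro a b hab
    induction hab with
    | zero_left g h h0 => simpa using componentRep_zero_left obj γ hinj hcl g h h0
    | zero_right g h h0 => simpa using componentRep_zero_right obj γ hinj hcl g h h0
    | left g h =>
      simp only [map_mul, map_smul, FreeAlgebra.lift_ι_apply]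
      rw [mul_assoc, componentRep_mul obj γ hinj hcl g h, mul_smul_comm, ← mul_assoc,
        componentRep_mul obj γ hinj hcl g⁻¹, smul_mul_assoc, mul_assoc, memDiagonal_mul_comm,
        ← mul_assoc, inv_mul_cancel_left, componentRep_mul_memDiagonal]
    | right g h =>
      simp only [map_mul, map_smul, FreeAlgebra.lift_ι_apply]
      rw [componentRep_mul obj γ hinj hcl g h, smul_mul_assoc, mul_assoc,
        memDiagonal_mul_componentRep]
    | one => simpa using componentRep_one obj γ hinj h11⟩

open Classical in
theorem componentHom_gen (h11 : σ 1 1 = 1) (g : G) :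
    componentHom obj γ hinj hcl h11 (ParAlg.gen σ g) = componentRep obj γ g := by
  rw [componentHom, ParAlg.gen, RingQuot.liftAlgHom_mkAlgHom_apply, FreeAlgebra.lift_ι_apply]

open Classical in
theorem componentHom_idem (h11 : σ 1 1 = 1) (g : G) :
    componentHom obj γ hinj hcl h11 (ParAlg.idem σ g) = memDiagonal obj A₀ g := by
  rw [ParAlg.idem, map_smul, map_mul, componentHom_gen, componentHom_gen,
    componentRep_mul obj γ hinj hcl, mul_inv_cancel, inv_inv, componentRep_one obj γ hinj h11,
    one_mul]
  by_cases h0 : σ g g⁻¹ = 0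
  · rw [h0, zero_smul, smul_zero]
    symm
    rw [memDiagonal, ← Matrix.diagonal_zero]
    congr 1
    funext x
    rw [if_neg]
    intro hg
    exact (obj x).sigma_ne_zero (s := 1) (obj x).one_mem (by simpa using hg)
      (by simpa using (obj x).one_mem) h0
  · rw [inv_smul_smul₀ h0]

end ComponentRep

/-! ### Atoms of a family of commuting idempotents -/

section Atoms

variable {G E : Type*} [CommRing E] (e : G → E) (U : Finset G)

open Classical in
/-- The product of the `e g` for `g ∈ t` and the `1 - e g` for `g ∉ t`, where `g ∈ U`. -/
noncomputable def idemAtom (t : Set G) : E := ∏ g ∈ U, if g ∈ t then e g else 1 - e g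

theorem mul_idemAtom_of_mem (he : ∀ g, e g * e g = e g) {h : G} (hU : h ∈ U) {t : Set G}
    (ht : h ∈ t) : e h * idemAtom e U t = idemAtom e U t := by
  classical
  rw [idemAtom, ← Finset.mul_prod_erase U _ hU, if_pos ht, ← mul_assoc, he]

theorem mul_idemAtom_of_notMem (he : ∀ g, e g * e g = e g) {h : G} (hU : h ∈ U) {t : Set G}
    (ht : h ∉ t) : e h * idemAtom e U t = 0 := by
  classical
  rw [idemAtom, ← Finset.mul_prod_erase U _ hU, if_neg ht, ← mul_assoc, mul_sub, he]
  simp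

/-- Expand the product of the factors `e_g + (1 - e_g) = 1`. -/
theorem sum_idemAtom : ∑ t ∈ U.powerset, idemAtom e U (t : Set G) = 1 := by
  classical
  have h := Finset.prod_add e (fun g => 1 - e g) U
  simp only [add_sub_cancel, Finset.prod_const_one] at h
  rw [h]
  refine Finset.sum_congr rfl fun t ht => ?_
  rw [idemAtom, ← Finset.prod_sdiff (Finset.mem_powerset.1 ht), mul_comm]
  congr 1
  · exact Finset.prod_congr rfl fun g hg => by simp [hg]
  · exact Finset.prod_congr rfl fun g hg => by simp [(Finset.mem_sdiff.1 hg).2]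

end Atoms

/-! ### The decomposition of the unit of `κ_par^σ G` -/

section Decomposition

variable {κ : Type*} {G : Type*} [Field κ] [Group G] {σ : G → G → κ}

/-- Over a finite set containing `1` and all points of `Ω_σ`, an atom that is not zero must be
indexed by an admissible set, so the expansion of `1` is a sum over `Ω_σ`. -/
theorem exists_atoms_of_commRing [Finite (OmegaSpace σ)] {E : Type*} [CommRing E] (e : G → E)
    (he : ∀ g, e g * e g = e g) (he1 : e 1 = 1)
    (h3 : ∀ s g h, σ g h = 0 → e s * e (s * g) * e (s * g * h) = 0)
    (h4 : ∀ s g h t, σ g h * σ (g * h) t ≠ σ g (h * t) * σ h t →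
      e s * e (s * g) * e (s * g * h) * e (s * g * h * t) = 0) :
    ∃ p : OmegaSpace σ → E, (∀ A, ∀ h ∈ A.carrier, e h * p A = p A) ∧
      (∀ A, ∀ h ∉ A.carrier, e h * p A = 0) ∧ ∑ᶠ A, p A = 1 := by
  classical
  have := Fintype.ofFinite (OmegaSpace σ)
  let V : Finset G := (OmegaSpace.finite_iUnion_carrier (σ := σ)).toFinset
  have hV (A : OmegaSpace σ) {g : G} (hg : g ∈ A.carrier) : g ∈ V := by
    simpa [V] using ⟨A, hg⟩
  have key (U : Finset G) (hU : 1 ∈ U) (t : Finset G) (ht : t ⊆ U)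
      (hne : idemAtom e U (t : Set G) ≠ 0) : OmegaSpace.Admissible σ (t : Set G) := by
    have hm {g : G} (hg : g ∈ (t : Set G)) := mul_idemAtom_of_mem e U he (ht hg) hg
    refine ⟨?_, ?_, ?_⟩
    · by_contra h1
      have := mul_idemAtom_of_notMem e U he hU h1
      rw [he1, one_mul] at this
      exact hne this
    · intro s g h hs hg hh h0
      apply hne
      rw [← hm hs, ← hm hg, ← hm hh, ← mul_assoc, ← mul_assoc, h3 s g h h0, zero_mul]
    · intro s g h k hs hg hh hk
      by_contra h0
      apply hne
      rw [← hm hs, ← hm hg, ← hm hh, ← hm hk, ← mul_assoc, ← mul_assoc, ← mul_assoc,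
        h4 s g h k h0, zero_mul]
  have hsum (U : Finset G) (hU : 1 ∈ U) (hVU : V ⊆ U) :
      ∑ A : OmegaSpace σ, idemAtom e U A.carrier = 1 := by
    rw [← sum_idemAtom e U]
    refine Finset.sum_of_injOn (fun A : OmegaSpace σ => U.filter (· ∈ A.carrier)) ?_ ?_ ?_ ?_
    · intro A _ B _ hAB
      ext g
      have := Finset.ext_iff.1 hAB g
      simp only [Finset.mem_filter] at this
      exact ⟨fun hg => (this.1 ⟨hVU (hV A hg), hg⟩).2, fun hg => (this.2 ⟨hVU (hV B hg), hg⟩).2⟩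
    · exact fun A _ => Finset.mem_coe.2 (Finset.mem_powerset.2 (Finset.filter_subset _ _))
    · intro t ht hnot
      by_contra hne
      have ht' := Finset.mem_powerset.1 ht
      refine hnot ⟨OmegaSpace.ofAdmissible (key U hU t ht' hne), by simp, ?_⟩
      ext g
      simp only [Finset.mem_filter, OmegaSpace.ofAdmissible, Finset.mem_coe]
      exact ⟨fun h => h.2, fun h => ⟨ht' h, h⟩⟩
    · intro A _
      congr 1
      ext g
      simp only [Finset.coe_filter]
      exact ⟨fun hg => ⟨hVU (hV A hg), hg⟩, fun hg => hg.2⟩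
  let U : Finset G := insert 1 V
  have hU : 1 ∈ U := Finset.mem_insert_self _ _
  have hVU : V ⊆ U := Finset.subset_insert _ _
  refine ⟨fun A => idemAtom e U A.carrier,
    fun A h hh => mul_idemAtom_of_mem e U he (hVU (hV A hh)) hh, fun A h hh => ?_, ?_⟩
  · by_cases hhU : h ∈ U
    · exact mul_idemAtom_of_notMem e U he hhU hh
    · have hz : e h = 0 := by
        rw [← mul_one (e h), ← hsum (insert h U) (Finset.mem_insert_of_mem hU)
          (hVU.trans (Finset.subset_insert _ _)), Finset.mul_sum]
        refine Finset.sum_eq_zero fun B _ =>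
          mul_idemAtom_of_notMem e _ he (Finset.mem_insert_self _ _) fun hB => ?_
        exact hhU (hVU (hV B hB))
      rw [hz, zero_mul]
  · rw [finsum_eq_sum_of_fintype]
    exact hsum U hU hVU

/-- A decomposition of the unit of `κ_par^σ G` into idempotents indexed by `Ω_σ`. -/
structure IsAtomFamily (p : OmegaSpace σ → ParAlg σ) : Prop where
  idem_mul_of_mem : ∀ A, ∀ h ∈ A.carrier, ParAlg.idem σ h * p A = p A
  idem_mul_of_notMem : ∀ A, ∀ h ∉ A.carrier, ParAlg.idem σ h * p A = 0
  mul_idem_of_mem : ∀ A, ∀ h ∈ A.carrier, p A * ParAlg.idem σ h = p A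
  mul_idem_of_notMem : ∀ A, ∀ h ∉ A.carrier, p A * ParAlg.idem σ h = 0
  finsum_eq_one : ∑ᶠ A, p A = 1

theorem exists_isAtomFamily [Finite (OmegaSpace σ)] :
    ∃ p : OmegaSpace σ → ParAlg σ, IsAtomFamily p := by
  have := Fintype.ofFinite (OmegaSpace σ)
  let E := Algebra.adjoin κ (Set.range (ParAlg.idem σ))
  have : IsMulCommutative E := Algebra.isMulCommutative_adjoin κ (by
    rintro _ ⟨g, rfl⟩ _ ⟨h, rfl⟩
    exact ParAlg.idem_mul_comm σ g h)
  let _ : CommRing E := { E.toRing with mul_comm := IsMulCommutative.is_comm.comm }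
  let e (g : G) : E := ⟨ParAlg.idem σ g, Algebra.subset_adjoin ⟨g, rfl⟩⟩
  obtain ⟨p, h1, h2, h3⟩ := exists_atoms_of_commRing (σ := σ) e
    (fun g => Subtype.ext (ParAlg.idem_mul_self σ g))
    (Subtype.ext (ParAlg.idem_one σ))
    (fun s g h h0 => Subtype.ext (ParAlg.idem_triple_eq_zero σ s g h h0))
    (fun s g h t h0 => Subtype.ext (ParAlg.idem_quadruple_eq_zero σ s g h t h0))
  refine ⟨fun A => (p A).1, fun A h hh => congrArg Subtype.val (h1 A h hh),
    fun A h hh => congrArg Subtype.val (h2 A h hh), fun A h hh => ?_, fun A h hh => ?_, ?_⟩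
  · exact congrArg Subtype.val ((mul_comm (p A) (e h)).trans (h1 A h hh))
  · exact congrArg Subtype.val ((mul_comm (p A) (e h)).trans (h2 A h hh))
  · rw [finsum_eq_sum_of_fintype] at h3 ⊢
    have h4 := congrArg E.val h3
    rw [map_sum] at h4
    exact h4

namespace IsAtomFamily

variable {p : OmegaSpace σ → ParAlg σ} (hp : IsAtomFamily p)

include hp

theorem mul_eq_zero {A B : OmegaSpace σ} (hAB : A ≠ B) : p A * p B = 0 := by
  have h : ∃ g, ¬ (g ∈ A.carrier ↔ g ∈ B.carrier) := by
    by_contra! h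
    exact hAB (OmegaSpace.ext (Set.ext h))
  obtain ⟨g, hg⟩ := h
  by_cases hA : g ∈ A.carrier
  · have hB : g ∉ B.carrier := fun hB => hg ⟨fun _ => hB, fun _ => hA⟩
    rw [← hp.mul_idem_of_mem A g hA, mul_assoc, hp.idem_mul_of_notMem B g hB, mul_zero]
  · have hB : g ∈ B.carrier := by
      by_contra hB
      exact hg ⟨fun h => absurd h hA, fun h => absurd h hB⟩
    rw [← hp.idem_mul_of_mem B g hB, ← mul_assoc, hp.mul_idem_of_notMem A g hA, zero_mul]

theorem gen_mul_of_notMem {A : OmegaSpace σ} {g : G} (h : g⁻¹ ∉ A.carrier) :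
    ParAlg.gen σ g * p A = 0 := by
  rw [← ParAlg.gen_mul_idem, mul_assoc, hp.idem_mul_of_notMem A _ h, mul_zero]

theorem gen_mul_gen_mul {A : OmegaSpace σ} {h : G} (g : G) (hA : h⁻¹ ∈ A.carrier) :
    ParAlg.gen σ g * (ParAlg.gen σ h * p A) = σ g h • (ParAlg.gen σ (g * h) * p A) := by
  rw [← hp.idem_mul_of_mem A _ hA, ← mul_assoc (ParAlg.gen σ h), ← mul_assoc,
    ParAlg.gen_mul_gen_mul_idem, smul_mul_assoc, mul_assoc]

variable [Finite (OmegaSpace σ)]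

theorem mul_self (A : OmegaSpace σ) : p A * p A = p A := by
  have := Fintype.ofFinite (OmegaSpace σ)
  have h := hp.finsum_eq_one
  rw [finsum_eq_sum_of_fintype] at h
  conv_rhs => rw [← mul_one (p A), ← h, Finset.mul_sum]
  rw [Finset.sum_eq_single A]
  · exact fun B _ hB => hp.mul_eq_zero hB.symm
  · simp

/-- The span contains `1 = ∑ p_A` and is stable under left multiplication by generators, hence is a
left ideal containing `1`. -/
theorem span_eq_top :
    Submodule.span κ (Set.range fun x : G × OmegaSpace σ => ParAlg.gen σ x.1 * p x.2) = ⊤ := by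
  have := Fintype.ofFinite (OmegaSpace σ)
  set V := Submodule.span κ (Set.range fun x : G × OmegaSpace σ => ParAlg.gen σ x.1 * p x.2)
    with hV
  have hgen (g : G) (A : OmegaSpace σ) : ParAlg.gen σ g * p A ∈ V :=
    Submodule.subset_span ⟨(g, A), rfl⟩
  have hone : (1 : ParAlg σ) ∈ V := by
    have h := hp.finsum_eq_one
    rw [finsum_eq_sum_of_fintype] at h
    rw [← h]
    refine Submodule.sum_mem _ fun A _ => ?_
    simpa [ParAlg.gen_one] using hgen 1 A
  have hmul (g : G) (v : ParAlg σ) (hv : v ∈ V) : ParAlg.gen σ g * v ∈ V := by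
    induction hv using Submodule.span_induction with
    | mem x hx =>
      obtain ⟨⟨h, A⟩, rfl⟩ := hx
      by_cases hA : h⁻¹ ∈ A.carrier
      · simp only [hp.gen_mul_gen_mul g hA]
        exact Submodule.smul_mem _ _ (hgen _ _)
      · simp [hp.gen_mul_of_notMem hA]
    | zero => simp
    | add x y _ _ hx hy => rw [mul_add]; exact add_mem hx hy
    | smul r x _ hx => rw [mul_smul_comm]; exact Submodule.smul_mem _ _ hx
  rw [eq_top_iff]
  rintro x -
  obtain ⟨y, rfl⟩ := RingQuot.mkAlgHom_surjective κ (ParRel σ) x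
  have hy : ∀ v ∈ V, RingQuot.mkAlgHom κ (ParRel σ) y * v ∈ V := by
    induction y using FreeAlgebra.induction with
    | grade0 r =>
      intro v hv
      rw [AlgHom.commutes, ← Algebra.smul_def]
      exact Submodule.smul_mem _ _ hv
    | grade1 g => exact hmul g
    | mul a b ha hb =>
      intro v hv
      rw [map_mul, mul_assoc]
      exact ha _ (hb _ hv)
    | add a b ha hb =>
      intro v hv
      rw [map_add, add_mul]
      exact add_mem (ha _ hv) (hb _ hv)
  simpa using hy 1 hone

end IsAtomFamily

end Decomposition

/-! ### The isomorphism -/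

section Isomorphism

variable {κ : Type*} {G : Type*} [Field κ] [Group G] {σ : G → G → κ}

/-- The element `r[g]p_A` given by the arrow `r(g, A)`. -/
noncomputable def arrowVal (p : OmegaSpace σ → ParAlg σ) {A B : OmegaSpace σ} (q : A ⟶ B) :
    ParAlg σ :=
  GammaHom.coeff q • (ParAlg.gen σ (GammaHom.elt q) * p A)

theorem arrowVal_scale (p : OmegaSpace σ → ParAlg σ) {A B : OmegaSpace σ} (s : κ) (hs : s ≠ 0)
    (q : A ⟶ B) : arrowVal p (GammaHom.scale s hs q) = s • arrowVal p q :=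
  mul_smul _ _ _

theorem arrowVal_ofElt (p : OmegaSpace σ → ParAlg σ) {A B : OmegaSpace σ} (g : G)
    (h1 : g⁻¹ ∈ A.carrier) (h2 : g • A.carrier = B.carrier) :
    arrowVal p (GammaHom.ofElt (B := B) g h1 h2) = ParAlg.gen σ g * p A :=
  one_smul _ _

/-- The linear map from the twisted group algebra of the stabilizer of `A₀` to `κ_par^σ G` which
transports the loops at `A₀` to arrows from `A` to `B`. -/
noncomputable def transport (p : OmegaSpace σ → ParAlg σ) {A₀ A B : OmegaSpace σ} (a : A₀ ⟶ A)
    (b : A₀ ⟶ B) : TwistedGroupAlgebra A₀.cocycle →ₗ[κ] ParAlg σ :=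
  Finsupp.lift (ParAlg σ) κ A₀.stab fun h => arrowVal p (inv a ≫
    GammaHom.ofElt (A := A₀) (B := A₀) h.1 (A₀.mem_of_mem_stab (inv_mem h.2)) h.2 ≫ b)

theorem transport_loopVal (p : OmegaSpace σ → ParAlg σ) {A₀ A B : OmegaSpace σ} (a : A₀ ⟶ A)
    (b : A₀ ⟶ B) (w : A₀ ⟶ A₀) :
    transport p a b (GammaHom.loopVal w) = arrowVal p (inv a ≫ w ≫ b) := by
  have h : GammaHom.loopVal w = GammaHom.coeff w •
      TwistedGroupAlgebra.single A₀.cocycle ⟨GammaHom.elt w, GammaHom.smul_eq w⟩ 1 := by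
    rw [TwistedGroupAlgebra.smul_single, mul_one]
    rfl
  conv_rhs => rw [GammaHom.eq_scale_ofElt w]
  rw [GammaHom.scale_comp, GammaHom.comp_scale, arrowVal_scale, h, map_smul]
  congr 1
  exact TwistedGroupAlgebra.lift_single (M := ParAlg σ) _ _

variable {A₀ : OmegaSpace σ} {X : Type*} (obj : X → OmegaSpace σ) (γ : ∀ x, A₀ ⟶ obj x)
  [Fintype X] (hinj : Function.Injective obj)
  (hcl : ∀ x (B : OmegaSpace σ), (obj x ⟶ B) → ∃ y, obj y = B) (h11 : σ 1 1 = 1)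
  {p : OmegaSpace σ → ParAlg σ} (hp : IsAtomFamily p)

open Classical in
include hp in
theorem componentHom_atom_of_ne (A : OmegaSpace σ) (y x : X) (h : obj y ≠ A) :
    componentHom obj γ hinj hcl h11 (p A) y x = 0 := by
  have h : ∃ g, ¬ (g ∈ (obj y).carrier ↔ g ∈ A.carrier) := by
    by_contra! h'
    exact h (OmegaSpace.ext (Set.ext h'))
  obtain ⟨g, hg⟩ := h
  have key := memDiagonal_mul_apply obj (componentHom obj γ hinj hcl h11 (p A)) g y x
  rw [← componentHom_idem obj γ hinj hcl h11, ← map_mul] at key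
  by_cases hA : g ∈ A.carrier
  · have hy : g ∉ (obj y).carrier := fun hy => hg ⟨fun _ => hA, fun _ => hy⟩
    rwa [hp.idem_mul_of_mem A g hA, if_neg hy] at key
  · have hy : g ∈ (obj y).carrier := by
      by_contra hy
      exact hg ⟨fun h => absurd h hy, fun h => absurd h hA⟩
    rw [hp.idem_mul_of_notMem A g hA, if_pos hy] at key
    rw [← key]
    simp

variable [Finite (OmegaSpace σ)]

open Classical in
include hp in
-- Row `y` of the image of `p_B` vanishes unless `B` is the object of `y`, and the images sum to the
-- identity, so the remaining row is that of the identity matrix.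
theorem componentHom_atom (A : OmegaSpace σ) :
    componentHom obj γ hinj hcl h11 (p A) =
      Matrix.diagonal fun x => if obj x = A then 1 else 0 := by
  have := Fintype.ofFinite (OmegaSpace σ)
  ext1 y x
  by_cases h : obj y = A
  · have h1 := hp.finsum_eq_one
    rw [finsum_eq_sum_of_fintype] at h1
    have h2 := congrArg (fun v => componentHom obj γ hinj hcl h11 v y x) h1
    simp only [map_sum, map_one, Matrix.sum_apply] at h2
    rw [Finset.sum_eq_single A] at h2
    · rw [h2, Matrix.one_apply, Matrix.diagonal_apply, if_pos h]
    · intro B _ hB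
      exact componentHom_atom_of_ne obj γ hinj hcl h11 hp B y x (h.trans_ne hB.symm)
    · simp
  · rw [componentHom_atom_of_ne obj γ hinj hcl h11 hp A y x h, Matrix.diagonal_apply, if_neg h,
      ite_self]

open Classical in
include hp in
theorem componentHom_gen_mul_atom (g : G) (A : OmegaSpace σ) (y x : X) :
    componentHom obj γ hinj hcl h11 (ParAlg.gen σ g * p A) y x =
      if obj x = A then componentRep obj γ g y x else 0 := by
  rw [map_mul, componentHom_gen, componentHom_atom obj γ hinj hcl h11 hp, Matrix.mul_diagonal]
  split_ifs <;> simp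

open Classical in
include hp in
theorem componentHom_arrowVal_of_ne {A B : OmegaSpace σ} (q : A ⟶ B) (h : ∀ x, obj x ≠ A) :
    componentHom obj γ hinj hcl h11 (arrowVal p q) = 0 := by
  ext1 y x
  rw [arrowVal, map_smul, Matrix.smul_apply, componentHom_gen_mul_atom obj γ hinj hcl h11 hp,
    if_neg (h x), smul_zero, Matrix.zero_apply]

open Classical in
include hp in
theorem componentHom_arrowVal {x y : X} (q : obj x ⟶ obj y) :
    componentHom obj γ hinj hcl h11 (arrowVal p q) =
      Matrix.single y x (GammaHom.loopVal (γ x ≫ q ≫ inv (γ y))) := by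
  ext1 y' x'
  rw [arrowVal, map_smul, Matrix.smul_apply, componentHom_gen_mul_atom obj γ hinj hcl h11 hp,
    hinj.eq_iff]
  by_cases hx : x' = x
  · subst hx
    rw [if_pos rfl]
    by_cases hy : y' = y
    · subst hy
      rw [Matrix.single_apply_same,
        componentRep_of_mem obj γ (GammaHom.inv_mem q) (GammaHom.smul_eq q),
        ← GammaHom.loopVal_scale _ (GammaHom.coeff_ne_zero q), ← GammaHom.comp_scale,
        ← GammaHom.scale_comp, ← GammaHom.eq_scale_ofElt]
    · rw [componentRep_of_notMem, smul_zero, Matrix.single_apply_of_row_ne (Ne.symm hy)]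
      rintro ⟨-, h⟩
      exact hy (hinj (OmegaSpace.ext (h.symm.trans (GammaHom.smul_eq q))))
  · rw [if_neg hx, smul_zero, Matrix.single_apply_of_col_ne _ _ (Ne.symm hx)]

open Classical in
include hp in
-- Column `x` of the matrix of `v` determines `v p_x`. Both sides are linear in `v`, so it suffices
-- to check `[g]p_A`, where at most one entry survives and conjugation by `γ` is undone.
theorem sum_transport_componentHom (x : X) (v : ParAlg σ) :
    ∑ y, transport p (γ x) (γ y) (componentHom obj γ hinj hcl h11 v y x) = v * p (obj x) := by
  have hv : v ∈ Submodule.span κ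
      (Set.range fun x : G × OmegaSpace σ => ParAlg.gen σ x.1 * p x.2) := by
    rw [hp.span_eq_top]
    trivial
  induction hv using Submodule.span_induction with
  | mem v hv =>
    obtain ⟨⟨g, A⟩, rfl⟩ := hv
    simp only [componentHom_gen_mul_atom obj γ hinj hcl h11 hp]
    by_cases hA : obj x = A
    · subst hA
      simp only [if_true]
      rw [mul_assoc, hp.mul_self]
      by_cases hg : g⁻¹ ∈ (obj x).carrier
      · obtain ⟨y, hy⟩ := exists_obj_smul obj hcl hg
        rw [Finset.sum_eq_single y]
        · rw [componentRep_of_mem obj γ hg hy, transport_loopVal]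
          simp [arrowVal_ofElt]
        · intro y' _ hne
          rw [componentRep_of_notMem, map_zero]
          rintro ⟨-, h⟩
          exact hne (hinj (OmegaSpace.ext (h.symm.trans hy)))
        · simp
      · rw [hp.gen_mul_of_notMem hg]
        refine Finset.sum_eq_zero fun y _ => ?_
        rw [componentRep_of_notMem obj γ fun h => hg h.1, map_zero]
    · simp only [if_neg hA, map_zero, Finset.sum_const_zero]
      rw [mul_assoc, hp.mul_eq_zero (Ne.symm hA), mul_zero]
  | zero => simp
  | add v w _ _ hv hw =>
    simp only [map_add, Matrix.add_apply, Finset.sum_add_distrib, hv, hw, add_mul]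
  | smul r v _ hv =>
    simp only [map_smul, Matrix.smul_apply, ← Finset.smul_sum, hv, smul_mul_assoc]

end Isomorphism

/-! ### Assembling the components -/

section Components

variable {κ : Type u} {G : Type v} [Field κ] [Group G] {σ : G → G → κ}

/-- The left relation at `(1,1)` reads `1 = σ(1,1)1` in `R`. A point of `Ω_σ` is needed to exclude
the zero ring, for which `σ = 0`. -/
theorem IsFactorSet.map_one_one (hσ : IsFactorSet.{u, v, w} σ) (A : OmegaSpace σ) :
    σ 1 1 = 1 := by
  obtain ⟨R, _, _, Γ, hΓ⟩ := hσ
  rcases subsingleton_or_nontrivial R with hR | hR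
  · exact absurd (hΓ.eq_zero 1 1 (Subsingleton.elim _ _)) (GammaHom.sigma_one_one A)
  · have h := hΓ.left 1 1
    simp only [inv_one, mul_one, hΓ.map_one] at h
    rw [← Algebra.algebraMap_eq_smul_one, ← map_one (algebraMap κ R)] at h
    exact ((algebraMap κ R).injective h).symm

theorem CategoryTheory.Zigzag.nonempty_hom {C : Type*} [Groupoid C] {A B : C}
    (h : Zigzag A B) : Nonempty (A ⟶ B) := by
  induction h with
  | refl => exact ⟨𝟙 A⟩
  | tail _ h ih =>
    obtain ⟨f⟩ := ih
    rcases h with ⟨⟨g⟩⟩ | ⟨⟨g⟩⟩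
    · exact ⟨f ≫ g⟩
    · exact ⟨f ≫ inv g⟩

theorem CategoryTheory.ConnectedComponents.nonempty_hom {C : Type*} [Groupoid C]
    {i : CategoryTheory.ConnectedComponents C} (A B : i.Component) : Nonempty (A.obj ⟶ B.obj) :=
  (Quotient.exact' (A.property.trans B.property.symm) : Zigzag A.obj B.obj).nonempty_hom

theorem CategoryTheory.ConnectedComponents.obj_injective {C : Type*} [Category C]
    (i : CategoryTheory.ConnectedComponents C) : Function.Injective fun x : i.Component => x.obj :=
  fun _ _ h => ObjectProperty.FullSubcategory.ext h

theorem CategoryTheory.ConnectedComponents.exists_obj_eq {C : Type*} [Category C]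
    {i : CategoryTheory.ConnectedComponents C} (x : i.Component) (B : C) (f : x.obj ⟶ B) :
    ∃ y : i.Component, y.obj = B :=
  ⟨⟨B, (Quotient.sound' (Zigzag.of_inv f) : Quotient.mk'' B = Quotient.mk'' x.obj).trans
    x.property⟩, rfl⟩

open Classical in
theorem nonempty_algEquiv_pi_component [Finite (OmegaSpace σ)] (hσ : IsFactorSet.{u, v, w} σ)
    [∀ i : CategoryTheory.ConnectedComponents (OmegaSpace σ), Fintype i.Component]
    (A : (i : CategoryTheory.ConnectedComponents (OmegaSpace σ)) → i.Component) :
    Nonempty (ParAlg σ ≃ₐ[κ] ((i : CategoryTheory.ConnectedComponents (OmegaSpace σ)) →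
      Matrix i.Component i.Component (TwistedGroupAlgebra (A i).obj.cocycle))) := by
  have := Fintype.ofFinite (OmegaSpace σ)
  have : Finite (CategoryTheory.ConnectedComponents (OmegaSpace σ)) := Quotient.finite _
  have := Fintype.ofFinite (CategoryTheory.ConnectedComponents (OmegaSpace σ))
  obtain ⟨p, hp⟩ := exists_isAtomFamily (σ := σ)
  let γ (i : CategoryTheory.ConnectedComponents (OmegaSpace σ)) (x : i.Component) : (A i).obj ⟶ x.obj :=
    (CategoryTheory.ConnectedComponents.nonempty_hom (A i) x).some
  have h11 (i : CategoryTheory.ConnectedComponents (OmegaSpace σ)) : σ 1 1 = 1 := hσ.map_one_one (A i).obj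
  let φ (i : CategoryTheory.ConnectedComponents (OmegaSpace σ)) :=
    componentHom (fun x : i.Component => x.obj) (γ i) i.obj_injective
      CategoryTheory.ConnectedComponents.exists_obj_eq (h11 i)
  let Φ := AlgHom.pi φ
  refine ⟨AlgEquiv.ofBijective Φ ⟨?_, ?_⟩⟩
  -- If all matrices of `v` vanish, every `v p_B` is zero, and `v = ∑ v p_B`.
  · rw [injective_iff_map_eq_zero]
    intro v hv
    have h := hp.finsum_eq_one
    rw [finsum_eq_sum_of_fintype] at h
    rw [← mul_one v, ← h, Finset.mul_sum]
    refine Finset.sum_eq_zero fun B _ => ?_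
    let i : CategoryTheory.ConnectedComponents (OmegaSpace σ) := CategoryTheory.ConnectedComponents.mk B
    have h1 := sum_transport_componentHom (fun x : i.Component => x.obj) (γ i) i.obj_injective
      CategoryTheory.ConnectedComponents.exists_obj_eq (h11 i) hp ⟨B, rfl⟩ v
    rw [← h1]
    have h2 : φ i v = 0 := congrFun hv i
    refine Finset.sum_eq_zero fun y _ => ?_
    have h3 := congrFun (congrFun h2 y) ⟨B, rfl⟩
    exact (congrArg _ h3).trans (map_zero _)
  -- Matrix units with coefficients in the isotropy algebra span the target, and these coefficients
  -- are spanned by loops.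
  · have key (i : CategoryTheory.ConnectedComponents (OmegaSpace σ)) (y x : i.Component)
        (t : TwistedGroupAlgebra (A i).obj.cocycle) :
        Pi.single i (Matrix.single y x t) ∈ LinearMap.range Φ.toLinearMap := by
      have hloop (w : (A i).obj ⟶ (A i).obj) :
          Pi.single i (Matrix.single y x (GammaHom.loopVal w)) ∈ LinearMap.range Φ.toLinearMap := by
        refine ⟨arrowVal p (inv (γ i x) ≫ w ≫ γ i y), ?_⟩
        funext j
        change φ j _ = _
        by_cases hj : j = i
        · subst hj
          rw [Pi.single_eq_same]
          refine (componentHom_arrowVal (fun x : j.Component => x.obj) (γ j) j.obj_injective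
            CategoryTheory.ConnectedComponents.exists_obj_eq (h11 j) hp _).trans ?_
          simp
        · rw [Pi.single_eq_of_ne hj]
          exact componentHom_arrowVal_of_ne (fun x : j.Component => x.obj) (γ j) j.obj_injective
            CategoryTheory.ConnectedComponents.exists_obj_eq (h11 j) hp _ fun z hz =>
              hj (z.property.symm.trans ((congrArg CategoryTheory.ConnectedComponents.mk hz).trans x.property))
      induction t using TwistedGroupAlgebra.induction with
      | h0 => simp
      | hadd s t hs ht =>
        rw [Matrix.single_add, Pi.single_add]
        exact add_mem hs ht
      | hs h r =>
        -- Arrows have nonzero coefficients, so `r = 0` is not a loop.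
        by_cases hr : r = 0
        · have : TwistedGroupAlgebra.single (A i).obj.cocycle h r = 0 := by
            rw [hr]
            exact Finsupp.single_zero _
          simp [this]
        · exact hloop (⟨r, h.1, hr, (A i).obj.mem_of_mem_stab (inv_mem h.2), h.2⟩ : GammaHom _ _)
    intro M
    have hM : M ∈ LinearMap.range Φ.toLinearMap := by
      rw [← Finset.univ_sum_single M]
      refine Submodule.sum_mem _ fun i _ => ?_
      change LinearMap.single κ (fun i : CategoryTheory.ConnectedComponents (OmegaSpace σ) =>
        Matrix i.Component i.Component (TwistedGroupAlgebra (A i).obj.cocycle)) i (M i) ∈ _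
      rw [Matrix.matrix_eq_sum_single (M i), map_sum]
      refine Submodule.sum_mem _ fun y _ => ?_
      rw [map_sum]
      exact Submodule.sum_mem _ fun x _ => key i y x _
    exact hM

end Components

theorem mainTheorem2 {κ : Type u} {G : Type v} [Field κ] [Group G] (σ : G → G → κ)
    (hσ : IsFactorSet.{u, v, w} σ) :
    (Finite G → DiscreteTopology (OmegaSpace σ)) ∧
    (DiscreteTopology (OmegaSpace σ) →
      Finite (OmegaSpace σ) ∧
      ∀ A : (i : CategoryTheory.ConnectedComponents (OmegaSpace σ)) → i.Component,
        Nonempty (ParAlg σ ≃ₐ[κ]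
          ((i : CategoryTheory.ConnectedComponents (OmegaSpace σ)) →
            Matrix (Fin (Nat.card i.Component)) (Fin (Nat.card i.Component))
              (TwistedGroupAlgebra (A i).obj.cocycle)))) := by
  classical
  -- A finite Hausdorff space is discrete; conversely, a compact discrete space is finite.
  refine ⟨fun _ => inferInstance, fun _ => ?_⟩
  have hfin : Finite (OmegaSpace σ) := finite_of_compact_of_discrete
  refine ⟨hfin, fun A => ?_⟩
  have (i : CategoryTheory.ConnectedComponents (OmegaSpace σ)) : Finite i.Component :=
    Finite.of_injective _ i.obj_injective
  have (i : CategoryTheory.ConnectedComponents (OmegaSpace σ)) : Fintype i.Component := Fintype.ofFinite _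
  obtain ⟨f⟩ := nonempty_algEquiv_pi_component hσ A
  exact ⟨f.trans (AlgEquiv.piCongrRight fun i =>
    Matrix.reindexAlgEquiv κ _ (Finite.equivFin i.Component))⟩
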